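/- Let $c$ be a nonzero integer and $\mu,\nu\in\mathbb R$. Let $M_c$ be the Heisenberg manifold, the quotient of $\mathbb R^3$ by the right action of $H_c=\{(m,n,p): m,n,cp\in\mathbb Z\}$ given by $(x,y,z)(m,n,p)=(x+m,y+n,z+p+ym)$, and for $k\in\mathbb Z$ let $$B_k=\{F\in C(M_c): F[x,y,z+t/c]=e^{2\pi i k t}F[x,y,z]\ \text{for all } t\in\mathbb R\}.$$ Equivalently, $B_k$ consists of the functions $F=e^{2\pi i kcz}f(x,y)$ with $f$ continuous, $f(x,y+1)=f(x,y)$ and $f(x+1,y)=e^{-2\pi i kcy}f(x,y)$. Put $\theta_k(x,y,z)=(x+2k\mu,\,y+2k\nu,\,z+2k\nu x+2k^2\mu\nu)$. A function $g$ on $M_c$, or a bounded measurable function $g$ on $\mathbb R\times\mathbb T^2$ (where $\mathbb T=\mathbb R/\mathbb Z$), that is regarded as an element of degree $k$ acts on $L^2(\mathbb R\times\mathbb T^2)$ by $\xi\mapsto g\cdot(\xi\circ\theta_k)$. Let $D^c_{\mu,\nu}$ be the quantum Heisenberg manifold, i.e. the $C^*$-algebra of operators generated by the elements of all $B_k$ (as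 elements of degree $k$), let $N=(D^c_{\mu,\nu})''$ be the von Neumann algebra it generates, and let $\tau$ be the canonical trace, i.e. the state of $D^c_{\mu,\nu}$ with $\tau(F)=\int_0^1\!\int_0^1\!\int_0^1 F[x,y,z]\,dz\,dy\,dx$ for $F\in B_k$, $k\in\mathbb Z$, extended to $N$ as the vector functional $\tau(T)=\langle\chi,T\chi\rangle$, where $\chi$ is the indicator function of $[0,1]\times\mathbb T^2$. Let $L^2(D^c_{\mu,\nu},\tau)$ be the GNS Hilbert space of $\tau$ and $\bar B_k$ the closure of $B_k$ in it. An operator $T\in N$ is regarded as the vector $\eta\in L^2(D^c_{\mu,\nu},\tau)$ with $\langle a,\eta\rangle=\tau(a^*T)$ for all $a\in D^c_{\mu,\nu}$ and $\|\eta\|^2=\tau(T^*T)$. Let $U$ and $V$ be the operators of the functions $e^{2\pi i x}$ and $e^{2\pi i y}$ in degree $0$, and let $W$ be the operator of the function $e^{2\pi i cz}e^{-2\pi i cx\{y\}}$ in degree $1$, where $\{y\}$ is the fractional part of $y$. These operators are unitary; $W^k=(W^*)^{-k}$ for $k<0$, and likewise for $U$ and $V$. Then the operators $U^mV^nW^k$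 $(m,n,k\in\mathbb Z)$ lie in $N$ and define vectors of $L^2(D^c_{\mu,\nu},\tau)$, and: 1. for every $k\in\mathbb Z$ there is a unitary isomorphism $\Phi_k:\bar B_k\to L^2(\mathbb T^2)$ with $$\Phi_k\bigl(e^{2\pi i kcz}f(x,y)\bigr)=e^{2\pi i ckx\{y\}}f(x,y)\qquad\text{for all } e^{2\pi i kcz}f(x,y)\in B_k;$$ 2. for every $k\in\mathbb Z$, $\{U^mV^nW^k\}_{m,n\in\mathbb Z}$ is an orthonormal basis of $\bar B_k$; 3. $\{U^mV^nW^k\}_{m,n,k\in\mathbb Z}$ is an orthonormal basis of $L^2(D^c_{\mu,\nu},\tau)$. -/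

import Mathlib

noncomputable section

namespace QHM

open MeasureTheory Set
open scoped ENNReal ComplexOrder

/-! ### The Heisenberg manifold, the gauge action and its spectral subspaces -/

/-- The orbit relation of the right action of `H_c = {(m, n, p) : m, n, c p ∈ ℤ}` on the Heisenberg
group `ℝ³`, with multiplication `(x, y, z)(m, n, p) = (x + m, y + n, z + p + y m)`. -/
def heisenbergSetoid (c : ℤ) : Setoid (ℝ × ℝ × ℝ) where
  r u v := ∃ m n : ℤ, ∃ p : ℝ, (∃ q : ℤ, (c : ℝ) * p = q) ∧
    v = (u.1 + m, u.2.1 + n, u.2.2 + p + u.2.1 * m)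
  iseqv := by
    refine ⟨fun u => ⟨0, 0, 0, ⟨0, by simp⟩, by simp⟩, ?_, ?_⟩
    · rintro u v ⟨m, n, p, ⟨q, hq⟩, rfl⟩
      refine ⟨-m, -n, -p + n * m, ⟨-q + c * n * m, ?_⟩, ?_⟩
      · push_cast
        rw [← hq]
        ring
      · ext
        · simp
        · simp
        · push_cast
          ring
    · rintro u v w ⟨m, n, p, ⟨q, hq⟩, rfl⟩ ⟨m', n', p', ⟨q', hq'⟩, rfl⟩
      refine ⟨m + m', n + n', p + p' + n * m', ⟨q + q' + c * n * m', ?_⟩, ?_⟩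
      · push_cast
        rw [← hq, ← hq']
        ring
      · ext
        · push_cast
          ring
        · push_cast
          ring
        · push_cast
          ring

/-- The Heisenberg manifold `M_c = G / H_c`, with the quotient topology. -/
def HeisenbergManifold (c : ℤ) : Type := Quotient (heisenbergSetoid c)

instance (c : ℤ) : TopologicalSpace (HeisenbergManifold c) :=
  inferInstanceAs (TopologicalSpace (Quotient (heisenbergSetoid c)))

/-- The class `[x, y, z]` in `M_c`. -/
def HeisenbergManifold.mk (c : ℤ) (u : ℝ × ℝ × ℝ) : HeisenbergManifold c :=
  Quotient.mk (heisenbergSetoid c) u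

theorem HeisenbergManifold.continuous_mk (c : ℤ) : Continuous (HeisenbergManifold.mk c) :=
  continuous_quotient_mk'

instance (c : ℤ) : CompactSpace (HeisenbergManifold c) := by
  have hK : IsCompact (HeisenbergManifold.mk c ''
      (Icc (0 : ℝ) 1 ×ˢ (Icc (0 : ℝ) 1 ×ˢ Icc (0 : ℝ) 1))) :=
    (isCompact_Icc.prod (isCompact_Icc.prod isCompact_Icc)).image
      (HeisenbergManifold.continuous_mk c)
  refine ⟨hK.of_isClosed_subset isClosed_univ ?_⟩
  intro a _
  obtain ⟨⟨x, y, z⟩, rfl⟩ := Quotient.exists_rep a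
  have hfr : ∀ t : ℝ, Int.fract t ∈ Icc (0 : ℝ) 1 := fun t =>
    ⟨Int.fract_nonneg t, (Int.fract_lt_one t).le⟩
  refine ⟨(Int.fract x, Int.fract y, Int.fract (z - y * ⌊x⌋)), ⟨hfr _, hfr _, hfr _⟩, ?_⟩
  refine Eq.symm (Quotient.sound (s := heisenbergSetoid c) ?_)
  refine ⟨-⌊x⌋, -⌊y⌋, -⌊z - y * ⌊x⌋⌋, ⟨-(c * ⌊z - y * ⌊x⌋⌋), by push_cast; ring⟩, ?_⟩
  have hf : ∀ t : ℝ, Int.fract t = t - ⌊t⌋ := fun _ => rfl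
  simp only [hf]
  ext
  · push_cast
    ring
  · push_cast
    ring
  · push_cast
    ring

/-- The gauge action `γ_{e^{2πit}} [x, y, z] = [x, y, z + t / c]` on `M_c`. -/
def gauge (c : ℤ) (t : ℝ) : HeisenbergManifold c → HeisenbergManifold c :=
  Quotient.map (sa := heisenbergSetoid c) (sb := heisenbergSetoid c)
    (fun u => (u.1, u.2.1, u.2.2 + t / c)) (by
      rintro u v ⟨m, n, p, hp, rfl⟩
      refine ⟨m, n, p, hp, ?_⟩
      ext
      · rfl
      · rfl
      · simp
        ring)

/-- The spectral subspace `B_k = {F ∈ C(M_c) : γ_{e^{2πit}}(F) = e^{2πikt} F for all t}`. -/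
def spectralSubspace (c k : ℤ) : Submodule ℂ C(HeisenbergManifold c, ℂ) where
  carrier := {F | ∀ (t : ℝ) (a : HeisenbergManifold c),
    F (gauge c t a) = Complex.exp (2 * Real.pi * Complex.I * k * t) * F a}
  add_mem' := by
    intro F G hF hG t a
    simp only [ContinuousMap.add_apply, hF t a, hG t a, mul_add]
  zero_mem' := by
    intro t a
    simp
  smul_mem' := by
    intro r F hF t a
    simp only [ContinuousMap.smul_apply, hF t a, smul_eq_mul]
    ring

/-! ### The Hilbert space `L²(ℝ × 𝕋²)` and the twisted multiplication operators -/

/-- `ℝ × 𝕋²` with coordinates `(x, y, z)`, and `𝕋 = ℝ / ℤ`; it carries the product of the Lebesgue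
measure and the normalized Haar measures. -/
abbrev Cylinder : Type := ℝ × UnitAddCircle × UnitAddCircle

/-- The Hilbert space `L²(ℝ × 𝕋²)`. -/
abbrev H : Type := Lp ℂ 2 (volume : Measure Cylinder)

/-- The quotient map `ℝ × 𝕋² → M_c`, `(x, y + ℤ, z + ℤ) ↦ [x, y, z]`. -/
def toManifold (c : ℤ) (u : Cylinder) : HeisenbergManifold c :=
  Quotient.liftOn₂' u.2.1 u.2.2 (fun y z => HeisenbergManifold.mk c (u.1, y, z)) (by
    intro y z y' z' hy hz
    rw [QuotientAddGroup.leftRel_apply, AddSubgroup.mem_zmultiples_iff] at hy hz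
    obtain ⟨n, hn⟩ := hy
    obtain ⟨p, hp⟩ := hz
    refine Quotient.sound (s := heisenbergSetoid c) ⟨0, n, p, ⟨c * p, by push_cast; ring⟩, ?_⟩
    simp only [zsmul_eq_mul, mul_one] at hn hp
    ext
    · simp
    · simp [hn]
    · simp [hp])

theorem toManifold_coe (c : ℤ) (x y z : ℝ) :
    toManifold c (x, (y : UnitAddCircle), (z : UnitAddCircle)) =
      HeisenbergManifold.mk c (x, y, z) := rfl

theorem continuous_toManifold (c : ℤ) : Continuous (toManifold c) := by
  have hq : IsOpenQuotientMap (fun y : ℝ => (y : UnitAddCircle)) :=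
    QuotientAddGroup.isOpenQuotientMap_mk
  have h := IsOpenQuotientMap.prodMap (IsOpenQuotientMap.id (X := ℝ)) (hq.prodMap hq)
  rw [← h.continuous_comp_iff]
  exact HeisenbergManifold.continuous_mk c

/-- The deformation flow `(x, y, z) ↦ (x + 2kμ, y + 2kν, z + 2kνx + 2k²μν)` (that is `θ_{kħ}` at
`ħ = 1`), on `ℝ × 𝕋²`. -/
def flow (μ ν : ℝ) (k : ℤ) (u : Cylinder) : Cylinder :=
  (u.1 + 2 * k * μ,
    u.2.1 + ((2 * k * ν : ℝ) : UnitAddCircle),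
    u.2.2 + ((2 * k * ν * u.1 + 2 * k ^ 2 * μ * ν : ℝ) : UnitAddCircle))

theorem measurePreserving_flow (μ ν : ℝ) (k : ℤ) : MeasurePreserving (flow μ ν k) := by
  have hc : Continuous fun t : ℝ => (t : UnitAddCircle) := AddCircle.continuous_mk' 1
  refine MeasurePreserving.skew_product (f := fun x : ℝ => x + 2 * k * μ)
    (g := fun (x : ℝ) (w : UnitAddCircle × UnitAddCircle) =>
      (w.1 + ((2 * k * ν : ℝ) : UnitAddCircle),
        w.2 + ((2 * k * ν * x + 2 * k ^ 2 * μ * ν : ℝ) : UnitAddCircle)))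
    (measurePreserving_add_right volume _) ?_ ?_
  · apply Continuous.measurable
    unfold Function.uncurry
    refine Continuous.prodMk (by fun_prop) ?_
    refine Continuous.add (by fun_prop) (hc.comp (by fun_prop))
  · refine Filter.Eventually.of_forall fun x => ?_
    exact ((measurePreserving_add_right (volume : Measure UnitAddCircle) _).prod
      (measurePreserving_add_right (volume : Measure UnitAddCircle) _)).map_eq

/-- For a bounded measurable function `g` on `ℝ × 𝕋²` the operator `ξ ↦ g · (ξ ∘ θ_k)` on
`L²(ℝ × 𝕋²)`. For `g` in `B_k` it is the left multiplication `ξ ↦ g × ξ = g θ_k(ξ)`. -/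
def twistedMul (μ ν : ℝ) (k : ℤ) (g : Lp ℂ ∞ (volume : Measure Cylinder)) : H →L[ℂ] H :=
  ((ContinuousLinearMap.mul ℂ ℂ).holderL volume ∞ 2 2 g) ∘L
    (Lp.compMeasurePreservingₗᵢ ℂ (flow μ ν k)
      (measurePreserving_flow μ ν k)).toContinuousLinearMap

theorem coeFn_twistedMul (μ ν : ℝ) (k : ℤ) (g : Lp ℂ ∞ (volume : Measure Cylinder)) (ξ : H) :
    (twistedMul μ ν k g ξ : Cylinder → ℂ) =ᵐ[volume] fun u => g u * ξ (flow μ ν k u) := by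
  have h1 := (ContinuousLinearMap.mul ℂ ℂ).coeFn_holder (r := 2) g
    (Lp.compMeasurePreserving (flow μ ν k) (measurePreserving_flow μ ν k) ξ)
  have h2 := Lp.coeFn_compMeasurePreserving ξ (measurePreserving_flow μ ν k)
  filter_upwards [h1, h2] with u hu1 hu2
  refine Eq.trans hu1 ?_
  rw [hu2]
  rfl

/-- A continuous function on `M_c`, as a bounded function on `ℝ × 𝕋²`. -/
def pullback (c : ℤ) (F : C(HeisenbergManifold c, ℂ)) : Lp ℂ ∞ (volume : Measure Cylinder) :=
  MemLp.toLp (fun u => F (toManifold c u))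
    (memLp_top_of_bound
      (F.continuous.comp (continuous_toManifold c)).aestronglyMeasurable ‖F‖
      (Filter.Eventually.of_forall fun _ => F.norm_coe_le_norm _))

/-! ### The quantum Heisenberg manifold -/

/-- The norm closed `*`-algebra of operators on `L²(ℝ × 𝕋²)` generated by the left multiplications
by elements of the spaces `B_k`, `k ∈ ℤ`. -/
def sectionAlgebra (c : ℤ) (μ ν : ℝ) : StarSubalgebra ℂ (H →L[ℂ] H) :=
  (StarAlgebra.adjoin ℂ {T | ∃ k : ℤ, ∃ F ∈ spectralSubspace c k,
    T = twistedMul μ ν k (pullback c F)}).topologicalClosure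

/-- The `C*`-algebra `D^c_{μν} = C(M_c)_γ^θ` of the quantum Heisenberg manifold. -/
def QuantumHeisenberg (c : ℤ) (μ ν : ℝ) : Type := sectionAlgebra c μ ν

instance (c : ℤ) (μ ν : ℝ) : IsClosed (sectionAlgebra c μ ν : Set (H →L[ℂ] H)) :=
  StarSubalgebra.isClosed_topologicalClosure _

instance (c : ℤ) (μ ν : ℝ) : CStarAlgebra (QuantumHeisenberg c μ ν) :=
  inferInstanceAs (CStarAlgebra (sectionAlgebra c μ ν))

/-- The usual order of a `C*`-algebra: positive elements are those of the form `b* b`. -/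
instance (c : ℤ) (μ ν : ℝ) : PartialOrder (QuantumHeisenberg c μ ν) :=
  CStarAlgebra.spectralOrder _

instance (c : ℤ) (μ ν : ℝ) : StarOrderedRing (QuantumHeisenberg c μ ν) :=
  CStarAlgebra.spectralOrderedRing _

/-- The inclusion of `D^c_{μν}` in the bounded operators on `L²(ℝ × 𝕋²)`. -/
def toOperator (c : ℤ) (μ ν : ℝ) : QuantumHeisenberg c μ ν →⋆ₐ[ℂ] (H →L[ℂ] H) :=
  (sectionAlgebra c μ ν).subtype

/-- The embedding of `B_k` in `D^c_{μν}`. -/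
def ofSpectral (c : ℤ) (μ ν : ℝ) (k : ℤ) (F : spectralSubspace c k) : QuantumHeisenberg c μ ν :=
  ⟨twistedMul μ ν k (pullback c F),
    StarSubalgebra.le_topologicalClosure _ (StarAlgebra.subset_adjoin ℂ _ ⟨k, F, F.2, rfl⟩)⟩

/-- The von Neumann algebra generated by `D^c_{μν}` on `L²(ℝ × 𝕋²)`, as the double commutant. -/
def vonNeumann (c : ℤ) (μ ν : ℝ) : Set (H →L[ℂ] H) :=
  Set.centralizer (Set.centralizer (sectionAlgebra c μ ν : Set (H →L[ℂ] H)))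

/-! ### The trace and its GNS space -/

theorem volume_unitCell : (volume : Measure Cylinder) (Icc (0 : ℝ) 1 ×ˢ univ) = 1 := by
  have h : (volume : Measure (UnitAddCircle × UnitAddCircle)) univ = 1 := by
    rw [Measure.volume_eq_prod, ← univ_prod_univ, Measure.prod_prod]
    simp
  rw [Measure.volume_eq_prod, Measure.prod_prod, h]
  simp

/-- The indicator function of `[0, 1] × 𝕋²`. -/
def cellVector : H :=
  indicatorConstLp 2 (s := Icc (0 : ℝ) 1 ×ˢ (univ : Set (UnitAddCircle × UnitAddCircle)))
    (measurableSet_Icc.prod MeasurableSet.univ) (by rw [volume_unitCell]; simp) (1 : ℂ)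

/-- The functional `T ↦ ⟨χ, T χ⟩`, `χ` being the indicator function of `[0, 1] × 𝕋²`. On the
operator of `F ∈ B_k` its value is the integral of `F` over `[0, 1]³`, see `trace_ofSpectral`; thus
it is the canonical trace `τ` on `D^c_{μν}`, extended normally to the generated von Neumann
algebra. -/
def operatorTrace (T : H →L[ℂ] H) : ℂ := inner ℂ cellVector (T cellVector)

/-- The canonical tracial state `τ` of `D^c_{μν}`. -/
def trace (c : ℤ) (μ ν : ℝ) : QuantumHeisenberg c μ ν →ₚ[ℂ] ℂ :=
  PositiveLinearMap.mk₀
    { toFun := fun a => operatorTrace (toOperator c μ ν a)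
      map_add' := fun a b => by simp [operatorTrace, inner_add_right]
      map_smul' := fun r a => by simp [operatorTrace, inner_smul_right] }
    (by
      intro a ha
      obtain ⟨b, rfl⟩ := CStarAlgebra.nonneg_iff_eq_star_mul_self.mp ha
      change 0 ≤ operatorTrace (toOperator c μ ν (star b * b))
      rw [map_mul, map_star, operatorTrace, ContinuousLinearMap.star_eq_adjoint,
        mul_apply_eq_comp, ContinuousLinearMap.adjoint_inner_right]
      rw [inner_self_eq_norm_sq_to_K]
      positivity)

theorem toManifold_rotate (c : ℤ) (s : ℝ) (hc : c ≠ 0) (u : Cylinder) :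
    toManifold c (u.1, u.2.1, u.2.2 + (s : UnitAddCircle)) = gauge c (c * s) (toManifold c u) := by
  obtain ⟨x, y, z⟩ := u
  induction y using QuotientAddGroup.induction_on with | _ y
  induction z using QuotientAddGroup.induction_on with | _ z
  have hc' : (c : ℝ) ≠ 0 := by exact_mod_cast hc
  have h : (c : ℝ) * s / c = s := by field_simp
  change HeisenbergManifold.mk c (x, y, z + s) = HeisenbergManifold.mk c (x, y, z + c * s / c)
  rw [h]

/-- The canonical trace is given on `B_k` by integration over `[0, 1]³`. -/
theorem trace_ofSpectral (c : ℤ) (hc : c ≠ 0) (μ ν : ℝ) (k : ℤ) (F : spectralSubspace c k) :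
    trace c μ ν (ofSpectral c μ ν k F) = ∫ x in (0 : ℝ)..1, ∫ y in (0 : ℝ)..1, ∫ z in (0 : ℝ)..1,
      F.1 (HeisenbergManifold.mk c (x, y, z)) := by
  set S : Set Cylinder := Icc (0 : ℝ) 1 ×ˢ univ with hS
  have hSm : MeasurableSet S := measurableSet_Icc.prod MeasurableSet.univ
  set f : Cylinder → ℂ := fun u => F.1 (toManifold c u) with hf
  have hfc : Continuous f := F.1.continuous.comp (continuous_toManifold c)
  have hfi : IntegrableOn f S := by
    refine Measure.integrableOn_of_bounded (M := ‖F.1‖) ?_ hfc.aestronglyMeasurable ?_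
    · rw [volume_unitCell]
      simp
    · exact Filter.Eventually.of_forall fun u => F.1.norm_coe_le_norm _
  have hR : ∫ x in (0 : ℝ)..1, ∫ y in (0 : ℝ)..1, ∫ z in (0 : ℝ)..1,
      F.1 (HeisenbergManifold.mk c (x, y, z)) = ∫ u in S, f u := by
    rw [hS, Measure.volume_eq_prod, setIntegral_prod _ hfi, intervalIntegral.integral_of_le
      zero_le_one, integral_Icc_eq_integral_Ioc]
    refine setIntegral_congr_fun measurableSet_Ioc fun x _ => ?_
    have hi : Integrable (fun w : UnitAddCircle × UnitAddCircle => f (x, w))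
        (volume.prod volume) :=
      Continuous.integrable_of_hasCompactSupport (by fun_prop)
        (HasCompactSupport.of_compactSpace _)
    simp only [setIntegral_univ]
    rw [Measure.volume_eq_prod, integral_prod _ hi]
    rw [← UnitAddCircle.intervalIntegral_preimage 0, zero_add]
    refine intervalIntegral.integral_congr fun y _ => ?_
    rw [← UnitAddCircle.intervalIntegral_preimage 0, zero_add]
    rfl
  have hL : trace c μ ν (ofSpectral c μ ν k F) =
      ∫ u, S.indicator (fun _ => (1 : ℂ)) u * (f u * S.indicator (fun _ => 1) (flow μ ν k u)) := by
    change inner ℂ cellVector (twistedMul μ ν k (pullback c F.1) cellVector) = _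
    rw [L2.inner_def]
    refine integral_congr_ae ?_
    have h1 : (cellVector : Cylinder → ℂ) =ᵐ[volume] S.indicator fun _ => 1 :=
      indicatorConstLp_coeFn
    have h2 := (measurePreserving_flow μ ν k).quasiMeasurePreserving.ae_eq_comp h1
    have h3 : (pullback c F.1 : Cylinder → ℂ) =ᵐ[volume] f := MemLp.coeFn_toLp _
    filter_upwards [h1, h2, h3, coeFn_twistedMul μ ν k (pullback c F.1) cellVector]
      with u e1 e2 e3 e4
    simp only [Function.comp_apply] at e2
    rw [e4, e1, e3, e2]
    by_cases hu : u ∈ S <;> simp [hu]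
  rw [hR, hL]
  by_cases hk : k = 0
  · subst hk
    rw [← integral_indicator hSm]
    refine integral_congr_ae (Filter.Eventually.of_forall fun u => ?_)
    have : flow μ ν 0 u = u := by simp [flow]
    simp only [this]
    by_cases hu : u ∈ S <;> simp [hu]
  · -- a rotation in the last coordinate changes the sign of `f`
    set s : ℝ := 1 / (2 * k * c) with hs
    have hck : (c : ℂ) ≠ 0 := by exact_mod_cast hc
    have hkk : (k : ℂ) ≠ 0 := by exact_mod_cast hk
    set R : Cylinder → Cylinder := fun u => (u.1, u.2.1, u.2.2 + (s : UnitAddCircle)) with hRdef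
    have hneg : ∀ u, f (R u) = -f u := by
      intro u
      simp only [hf, hRdef]
      rw [toManifold_rotate c s hc, F.2]
      have : 2 * (Real.pi : ℂ) * Complex.I * k * ((c * s : ℝ) : ℂ) = Real.pi * Complex.I := by
        rw [hs]
        push_cast
        field_simp
      rw [this, Complex.exp_pi_mul_I]
      ring
    have hRS : ∀ u, S.indicator (fun _ => (1 : ℂ)) (R u) = S.indicator (fun _ => 1) u := by
      intro u
      simp [hS, hRdef, indicator]
    have hRF : ∀ u, S.indicator (fun _ => (1 : ℂ)) (flow μ ν k (R u)) =
        S.indicator (fun _ => 1) (flow μ ν k u) := by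
      intro u
      simp [hS, hRdef, indicator, flow]
    have hmp : MeasurePreserving R :=
      (MeasurePreserving.id volume).prod ((MeasurePreserving.id volume).prod
        (measurePreserving_add_right (volume : Measure UnitAddCircle) _))
    have hme : MeasurableEmbedding R :=
      ((MeasurableEquiv.refl ℝ).prodCongr ((MeasurableEquiv.refl UnitAddCircle).prodCongr
        (MeasurableEquiv.addRight (s : UnitAddCircle)))).measurableEmbedding
    have key : ∀ g : Cylinder → ℂ, (∀ u, g (R u) = -g u) → ∫ u, g u = 0 := by
      intro g hg
      have h := hmp.integral_comp hme g
      simp only [hg, integral_neg] at h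
      exact self_eq_neg.mp h.symm
    rw [← integral_indicator hSm, key, key]
    · intro u
      have e : ∀ v, S.indicator f v = S.indicator (fun _ => (1 : ℂ)) v * f v := by
        intro v
        by_cases hv : v ∈ S <;> simp [hv]
      rw [e, e, hRS, hneg]
      ring
    · intro u
      rw [hRS, hRF, hneg]
      ring

/-- `L²(D^c_{μν}, τ)`: the Hilbert space of the GNS representation of `τ`. -/
abbrev L2 (c : ℤ) (μ ν : ℝ) : Type := (trace c μ ν).GNS

/-- The canonical map `D^c_{μν} → L²(D^c_{μν}, τ)`. -/
def toL2 (c : ℤ) (μ ν : ℝ) (a : QuantumHeisenberg c μ ν) : L2 c μ ν :=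
  ((trace c μ ν).toPreGNS a : (trace c μ ν).GNS)

/-- The completion `B̄_k` of `B_k` under `τ`, as a closed subspace of `L²(D^c_{μν}, τ)`. -/
def completedSpectral (c : ℤ) (μ ν : ℝ) (k : ℤ) : Submodule ℂ (L2 c μ ν) :=
  (Submodule.span ℂ (range fun F : spectralSubspace c k =>
    toL2 c μ ν (ofSpectral c μ ν k F))).topologicalClosure

/-- The image of `F ∈ B_k` in `B̄_k`. -/
def toCompleted (c : ℤ) (μ ν : ℝ) (k : ℤ) (F : spectralSubspace c k) :
    completedSpectral c μ ν k :=
  ⟨toL2 c μ ν (ofSpectral c μ ν k F),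
    Submodule.le_topologicalClosure _ (Submodule.subset_span ⟨F, rfl⟩)⟩

/-- The vector `η` of `L²(D^c_{μν}, τ)` is the class of the operator `T` in the von Neumann algebra
generated by `D^c_{μν}`: one has `⟨a, η⟩ = τ(a* T)` for all `a` in `D^c_{μν}`, and
`⟨η, η⟩ = τ(T* T)`. Since `D^c_{μν}` is dense, there is at most one such `η`. -/
def IsClassOf (c : ℤ) (μ ν : ℝ) (η : L2 c μ ν) (T : H →L[ℂ] H) : Prop :=
  T ∈ vonNeumann c μ ν ∧
  (∀ a : QuantumHeisenberg c μ ν,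
    inner ℂ (toL2 c μ ν a) η = operatorTrace (star (toOperator c μ ν a) * T)) ∧
  inner ℂ η η = operatorTrace (star T * T)

/-! ### The unitaries `U`, `V`, `W` -/

/-- The representative in `[0, 1)` of a point of `𝕋 = ℝ / ℤ`. -/
def frac (t : UnitAddCircle) : ℝ := (AddCircle.equivIco 1 0 t : ℝ)

theorem measurable_frac : Measurable frac :=
  measurable_subtype_coe.comp (AddCircle.measurableEquivIco 1 0).measurable

theorem frac_coe (y : ℝ) : frac (y : UnitAddCircle) = Int.fract y := by
  simp [frac, AddCircle.coe_equivIco_mk_apply]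

/-- The function `e^{2πix}`. -/
def funU (u : Cylinder) : ℂ := Complex.exp (2 * Real.pi * Complex.I * u.1)

/-- The function `e^{2πiy}`. -/
def funV (u : Cylinder) : ℂ := fourier 1 u.2.1

/-- The function `e^{2πicz} e^{-2πicx{y}}`. -/
def funW (c : ℤ) (u : Cylinder) : ℂ :=
  fourier c u.2.2 * Complex.exp (-(2 * Real.pi * Complex.I * c * u.1 * frac u.2.1))

theorem memLp_funU : MemLp funU ∞ (volume : Measure Cylinder) := by
  refine memLp_top_of_bound (Continuous.aestronglyMeasurable ?_) 1
    (Filter.Eventually.of_forall fun u => le_of_eq ?_)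
  · unfold funU
    fun_prop
  · simp [funU, Complex.norm_exp]

theorem memLp_funV : MemLp funV ∞ (volume : Measure Cylinder) := by
  refine memLp_top_of_bound (Continuous.aestronglyMeasurable ?_) 1
    (Filter.Eventually.of_forall fun u => le_of_eq ?_)
  · unfold funV
    fun_prop
  · simp only [funV, fourier_apply, Circle.norm_coe]

theorem memLp_funW (c : ℤ) : MemLp (funW c) ∞ (volume : Measure Cylinder) := by
  refine memLp_top_of_bound (Measurable.aestronglyMeasurable ?_) 1
    (Filter.Eventually.of_forall fun u => le_of_eq ?_)
  · have h1 : Measurable fun u : Cylinder => (fourier c u.2.2 : ℂ) :=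
      ((fourier c).continuous.measurable).comp (measurable_snd.comp measurable_snd)
    have h2 : Measurable fun u : Cylinder => ((frac u.2.1 : ℝ) : ℂ) :=
      Complex.measurable_ofReal.comp
        (measurable_frac.comp (measurable_fst.comp measurable_snd))
    unfold funW
    fun_prop
  · simp only [funW, fourier_apply, norm_mul, Circle.norm_coe, Complex.norm_exp]
    simp

/-- `U = e^{2πix}`, of degree `0`. -/
def U (μ ν : ℝ) : H →L[ℂ] H := twistedMul μ ν 0 memLp_funU.toLp

/-- `V = e^{2πiy}`, of degree `0`. -/
def V (μ ν : ℝ) : H →L[ℂ] H := twistedMul μ ν 0 memLp_funV.toLp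

/-- `W = e^{2πicz} e^{-2πicx{y}}`, of degree `1`. -/
def W (c : ℤ) (μ ν : ℝ) : H →L[ℂ] H := twistedMul μ ν 1 (memLp_funW c).toLp

/-- Integer powers of a unitary operator: `T^k` for `k ≥ 0` and `(T*)^{-k}` for `k < 0`. -/
def intPow (T : H →L[ℂ] H) : ℤ → (H →L[ℂ] H)
  | Int.ofNat n => T ^ n
  | Int.negSucc n => star T ^ (n + 1)

/-- The element `U^m V^n W^k`. -/
def monomial (c : ℤ) (μ ν : ℝ) (m n k : ℤ) : H →L[ℂ] H :=
  intPow (U μ ν) m * intPow (V μ ν) n * intPow (W c μ ν) k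

end QHM

end

/-! Since `τ` is the vector functional of `χ = cellVector`, the map `a ↦ aχ` is isometric for the
GNS norm, so `L²(D, τ)` embeds in `L²(ℝ × 𝕋²)` (`gnsIsometry`) and every assertion can be checked on
concrete functions there.

The unimodular function `phase c k` trivialises the line bundle of degree `k` measurably: every
element of `B_k` is `phase c k` times a bounded function `h` of `(x, y) ∈ 𝕋²`
(`spectral_eq_sectionFun`). Applied to `χ`, such an operator gives `phase · h` cut off to the cell
where `x + 2kμ ∈ [0, 1]`, a full period in `x`; this depends isometrically on `h ∈ L²(𝕋²)`
(`sectionIsometry`). The phase jumps only along `y = 0`, so multiplying a continuous `h` by cut-offs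
vanishing there gives elements of `B_k` that converge strongly to the operator of `phase · h`. Hence
the image of `B̄_k` is the whole range of the isometry (`map_completedSpectral`), which yields
`Φ_k`; the same approximation puts `U`, `V`, `W` in the bicommutant.

Phases multiply up to a unimodular cocycle on `𝕋²` (`phase_mul_phase_flow`). Therefore `W^k` is
`phase c k` times a unimodular `ω` on `𝕋²`, and `U^m V^n W^k χ` corresponds to `e^{2πi(mx+ny)} ω`.
This is the Fourier basis of `L²(𝕋²)` moved by the unitary multiplication by `ω`, so it is an
orthonormal basis.

Different degrees are orthogonal because they have different frequencies in `z`
(`inner_sectionIsometry_of_ne`). They fill the GNS space because the closed span of the ranges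
contains `χ` and is invariant under the generators and their adjoints
(`toOperator_apply_mem_sectionSpace`). -/

noncomputable section

namespace QHM

open MeasureTheory Set Filter Topology
open scoped ENNReal ComplexOrder

/-! ### Weighted composition operators -/

section WeightedComp

variable {X Y : Type*} [MeasurableSpace X] [MeasurableSpace Y] {μ : Measure X} {ν : Measure Y}

theorem memLp_weightedComp {w : X → ℂ} {S : Set X} {p : X → Y} (hw : Measurable w)
    (hw1 : ∀ x, ‖w x‖ = 1) (hS : MeasurableSet S) (hp : MeasurePreserving p (μ.restrict S) ν)
    {h : Y → ℂ} (hh : MemLp h 2 ν) :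
    MemLp (S.indicator fun x => w x * h (p x)) 2 μ := by
  rw [memLp_indicator_iff_restrict hS]
  have h1 : MemLp (h ∘ p) 2 (μ.restrict S) := hh.comp_measurePreserving hp
  refine h1.congr_norm (hw.aestronglyMeasurable.mul h1.1) ?_
  exact Filter.Eventually.of_forall fun x => by simp [hw1]

theorem indicator_comp_ae_eq {S : Set X} {p : X → Y} (hS : MeasurableSet S)
    (hp : MeasurePreserving p (μ.restrict S) ν) (w : X → ℂ) {h g : Y → ℂ} (hg : h =ᵐ[ν] g) :
    (S.indicator fun x => w x * h (p x)) =ᵐ[μ] S.indicator fun x => w x * g (p x) := by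
  have h1 := (ae_restrict_iff' hS).1 (hp.quasiMeasurePreserving.ae_eq_comp hg)
  filter_upwards [h1] with x hx
  by_cases hxS : x ∈ S
  · have := hx hxS
    simp only [Function.comp_apply] at this
    simp [hxS, this]
  · simp [hxS]

/-- The isometry `h ↦ 1_S · w · (h ∘ p)` of `L²` spaces, for a unimodular weight `w` and a map `p`
that is measure preserving on `S`. -/
def weightedComp {w : X → ℂ} {S : Set X} {p : X → Y} (hw : Measurable w)
    (hw1 : ∀ x, ‖w x‖ = 1) (hS : MeasurableSet S) (hp : MeasurePreserving p (μ.restrict S) ν) :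
    Lp ℂ 2 ν →ₗᵢ[ℂ] Lp ℂ 2 μ where
  toFun h := (memLp_weightedComp hw hw1 hS hp (Lp.memLp h)).toLp
  map_add' h g := by
    rw [← MemLp.toLp_add]
    refine MemLp.toLp_congr _ _ ((indicator_comp_ae_eq hS hp w (Lp.coeFn_add h g)).trans ?_)
    refine Filter.Eventually.of_forall fun x => ?_
    by_cases hxS : x ∈ S <;> simp [hxS, mul_add]
  map_smul' r h := by
    rw [RingHom.id_apply, ← MemLp.toLp_const_smul]
    refine MemLp.toLp_congr _ _ ((indicator_comp_ae_eq hS hp w (Lp.coeFn_smul r h)).trans ?_)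
    refine Filter.Eventually.of_forall fun x => ?_
    by_cases hxS : x ∈ S <;> simp [hxS, mul_left_comm]
  norm_map' h := by
    change ‖(memLp_weightedComp hw hw1 hS hp (Lp.memLp h)).toLp‖ = ‖h‖
    rw [Lp.norm_toLp, eLpNorm_indicator_eq_eLpNorm_restrict hS, Lp.norm_def,
      ← eLpNorm_comp_measurePreserving (Lp.aestronglyMeasurable h) hp]
    congr 1
    exact eLpNorm_congr_norm_ae (Filter.Eventually.of_forall fun x => by simp [hw1])

theorem weightedComp_toLp {w : X → ℂ} {S : Set X} {p : X → Y} (hw : Measurable w)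
    (hw1 : ∀ x, ‖w x‖ = 1) (hS : MeasurableSet S) (hp : MeasurePreserving p (μ.restrict S) ν)
    {h : Y → ℂ} (hh : MemLp h 2 ν) :
    (weightedComp hw hw1 hS hp hh.toLp : X → ℂ) =ᵐ[μ] S.indicator fun x => w x * h (p x) :=
  (MemLp.coeFn_toLp (memLp_weightedComp hw hw1 hS hp (Lp.memLp hh.toLp))).trans
    (indicator_comp_ae_eq hS hp w hh.coeFn_toLp)

theorem integral_eq_integral_comp {p : X → Y} (hp : MeasurePreserving p μ ν) {f : Y → ℂ}
    (hf : AEStronglyMeasurable f ν) : ∫ y, f y ∂ν = ∫ x, f (p x) ∂μ := by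
  rw [← hp.map_eq] at hf
  rw [← integral_map hp.aemeasurable hf, hp.map_eq]

end WeightedComp

/-! ### Operators of the form `ξ ↦ g · (ξ ∘ θ_k)` -/

/-- The term `2k²μν` makes the flow additive in `k`: composing `θ_k` with `θ_l` creates a cross term
`4klμν`, which completes the square `2(k + l)²μν`. -/
theorem flow_flow (μ ν : ℝ) (k l : ℤ) (u : Cylinder) :
    flow μ ν l (flow μ ν k u) = flow μ ν (k + l) u := by
  simp only [flow, Prod.mk.injEq]
  refine ⟨by push_cast; ring, ?_, ?_⟩
  · rw [add_assoc, ← AddCircle.coe_add]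
    congr 2
    push_cast; ring
  · rw [add_assoc, ← AddCircle.coe_add]
    congr 2
    push_cast; ring

theorem flow_zero (μ ν : ℝ) (u : Cylinder) : flow μ ν 0 u = u := by
  simp [flow]

/-- `T` is the operator `ξ ↦ g · (ξ ∘ θ_k)`. -/
def IsTwistedBy (μ ν : ℝ) (k : ℤ) (g : Cylinder → ℂ) (T : H →L[ℂ] H) : Prop :=
  ∀ ξ : H, (T ξ : Cylinder → ℂ) =ᵐ[volume] fun u => g u * ξ (flow μ ν k u)

theorem isTwistedBy_twistedMul (μ ν : ℝ) (k : ℤ) {g : Cylinder → ℂ} (hg : MemLp g ∞ volume) :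
    IsTwistedBy μ ν k g (twistedMul μ ν k hg.toLp) := fun ξ => by
  filter_upwards [coeFn_twistedMul μ ν k hg.toLp ξ, hg.coeFn_toLp] with u h1 h2
  rw [h1, h2]

namespace IsTwistedBy

variable {μ ν : ℝ} {k l : ℤ} {g g' : Cylinder → ℂ} {T S : H →L[ℂ] H}

theorem congr (hT : IsTwistedBy μ ν k g T) (h : ∀ u, g u = g' u) : IsTwistedBy μ ν k g' T := by
  rwa [← funext h]

protected theorem one (μ ν : ℝ) : IsTwistedBy μ ν 0 (fun _ => 1) 1 := fun ξ => by
  refine Filter.Eventually.of_forall fun u => ?_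
  simp [flow_zero]

theorem mul (hT : IsTwistedBy μ ν k g T) (hS : IsTwistedBy μ ν l g' S) :
    IsTwistedBy μ ν (k + l) (fun u => g u * g' (flow μ ν k u)) (T * S) := fun ξ => by
  have h := (measurePreserving_flow μ ν k).quasiMeasurePreserving.ae_eq_comp (hS ξ)
  filter_upwards [hT (S ξ), h] with u h1 h2
  simp only [Function.comp_apply] at h2
  rw [mul_apply_eq_comp, h1, h2, flow_flow, mul_assoc]

theorem star (hT : IsTwistedBy μ ν k g T) (hg : Measurable g) {C : ℝ} (hC : ∀ u, ‖g u‖ ≤ C) :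
    IsTwistedBy μ ν (-k) (fun u => star (g (flow μ ν (-k) u))) (star T) := by
  have hm : MemLp (fun u => Star.star (g (flow μ ν (-k) u))) ∞ (volume : Measure Cylinder) := by
    refine memLp_top_of_bound ?_ C (Filter.Eventually.of_forall fun u => ?_)
    · exact (continuous_star.measurable.comp
        (hg.comp (measurePreserving_flow μ ν (-k)).measurable)).aestronglyMeasurable
    · simpa using hC _
  have h1 := isTwistedBy_twistedMul μ ν (-k) hm
  have : twistedMul μ ν (-k) hm.toLp = Star.star T := by
    rw [ContinuousLinearMap.star_eq_adjoint, ContinuousLinearMap.eq_adjoint_iff]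
    intro ξ η
    rw [L2.inner_def, L2.inner_def]
    have hmp := measurePreserving_flow μ ν k
    have hf : AEStronglyMeasurable (fun u => inner ℂ ((twistedMul μ ν (-k) hm.toLp) ξ u) (η u))
        (volume : Measure Cylinder) :=
      (Lp.aestronglyMeasurable _).inner (Lp.aestronglyMeasurable _)
    -- Substituting `θ_k u` for `u` turns the weight of degree `-k` back into the conjugate of `g
    -- u`.
    rw [integral_eq_integral_comp hmp hf]
    refine integral_congr_ae ?_
    filter_upwards [hmp.quasiMeasurePreserving.ae_eq_comp (h1 ξ), hT η] with u e1 e2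
    simp only [Function.comp_apply] at e1
    rw [e1, e2, flow_flow, add_neg_cancel, flow_zero]
    simp only [RCLike.inner_apply, map_mul, RCLike.star_def, Complex.conj_conj]
    ring
  rwa [← this]

end IsTwistedBy

/-! ### Measurable sections -/

/-- The unimodular function `e^{2πikcz} e^{-2πikcx{y}}` of degree `k`. -/
def phase (c k : ℤ) (u : Cylinder) : ℂ :=
  fourier (k * c) u.2.2 * Complex.exp (-(2 * Real.pi * Complex.I * (k * c * u.1 * frac u.2.1)))

/-- The projection `(x, y, z) ↦ (x, y)` of `ℝ × 𝕋²` onto `𝕋²`. -/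
def proj (u : Cylinder) : UnitAddCircle × UnitAddCircle := ((u.1 : UnitAddCircle), u.2.1)

/-- The rotation of `𝕋²` induced by the flow. -/
def rotation (μ ν : ℝ) (k : ℤ) (w : UnitAddCircle × UnitAddCircle) :
    UnitAddCircle × UnitAddCircle :=
  (w.1 + ((2 * k * μ : ℝ) : UnitAddCircle), w.2 + ((2 * k * ν : ℝ) : UnitAddCircle))

/-- The cocycle on `𝕋²` by which the phases multiply. -/
def cocycle (c : ℤ) (μ ν : ℝ) (k l : ℤ) (w : UnitAddCircle × UnitAddCircle) : ℂ :=
  Complex.exp (2 * Real.pi * Complex.I * (l * c * (frac w.1 * (2 * k * ν + frac w.2 -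
    frac (w.2 + ((2 * k * ν : ℝ) : UnitAddCircle))) + 2 * k ^ 2 * μ * ν -
      2 * k * μ * frac (w.2 + ((2 * k * ν : ℝ) : UnitAddCircle)))))

theorem norm_exp_two_pi_I_mul (t : ℝ) : ‖Complex.exp (2 * Real.pi * Complex.I * t)‖ = 1 := by
  rw [show 2 * (Real.pi : ℂ) * Complex.I * t = ((2 * Real.pi * t : ℝ) : ℂ) * Complex.I by
    push_cast; ring]
  exact Complex.norm_exp_ofReal_mul_I _

theorem fourier_one_coe (n : ℤ) (t : ℝ) :
    fourier n (t : UnitAddCircle) = Complex.exp (2 * Real.pi * Complex.I * (n * t)) := by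
  rw [fourier_coe_apply]
  congr 1
  push_cast
  ring

theorem norm_fourier_apply (n : ℤ) (t : UnitAddCircle) : ‖(fourier n t : ℂ)‖ = 1 := by
  rw [fourier_apply]
  exact Circle.norm_coe _

theorem norm_phase (c k : ℤ) (u : Cylinder) : ‖phase c k u‖ = 1 := by
  have := norm_exp_two_pi_I_mul (-(k * c * u.1 * frac u.2.1))
  rw [phase, norm_mul, norm_fourier_apply, one_mul, ← this]
  congr 2
  push_cast
  ring

theorem norm_cocycle (c : ℤ) (μ ν : ℝ) (k l : ℤ) (w : UnitAddCircle × UnitAddCircle) :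
    ‖cocycle c μ ν k l w‖ = 1 := by
  rw [cocycle]
  generalize frac (w.2 + ((2 * k * ν : ℝ) : UnitAddCircle)) = s
  rw [← norm_exp_two_pi_I_mul (l * c * (frac w.1 * (2 * k * ν + frac w.2 - s) +
    2 * k ^ 2 * μ * ν - 2 * k * μ * s))]
  congr 2
  push_cast
  ring

theorem measurable_phase (c k : ℤ) : Measurable (phase c k) := by
  have h1 : Measurable fun u : Cylinder => (fourier (k * c) u.2.2 : ℂ) :=
    ((fourier (k * c)).continuous.measurable).comp (measurable_snd.comp measurable_snd)
  have h2 : Measurable fun u : Cylinder => ((frac u.2.1 : ℝ) : ℂ) :=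
    Complex.measurable_ofReal.comp (measurable_frac.comp (measurable_fst.comp measurable_snd))
  unfold phase
  fun_prop

theorem continuous_proj : Continuous proj :=
  ((AddCircle.continuous_mk' 1).comp continuous_fst).prodMk
    (continuous_fst.comp continuous_snd)

theorem measurable_proj : Measurable proj := continuous_proj.measurable

theorem measurable_rotation (μ ν : ℝ) (k : ℤ) : Measurable (rotation μ ν k) := by
  unfold rotation
  fun_prop

theorem measurable_cocycle (c : ℤ) (μ ν : ℝ) (k l : ℤ) : Measurable (cocycle c μ ν k l) := by
  have h1 : Measurable fun w : UnitAddCircle × UnitAddCircle => ((frac w.1 : ℝ) : ℂ) :=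
    Complex.measurable_ofReal.comp (measurable_frac.comp measurable_fst)
  have h2 : Measurable fun w : UnitAddCircle × UnitAddCircle => ((frac w.2 : ℝ) : ℂ) :=
    Complex.measurable_ofReal.comp (measurable_frac.comp measurable_snd)
  have h3 : Measurable fun w : UnitAddCircle × UnitAddCircle =>
      ((frac (w.2 + ((2 * k * ν : ℝ) : UnitAddCircle)) : ℝ) : ℂ) :=
    Complex.measurable_ofReal.comp (measurable_frac.comp (measurable_snd.add_const _))
  unfold cocycle
  fun_prop

theorem phase_zero (c : ℤ) (u : Cylinder) : phase c 0 u = 1 := by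
  simp [phase]

theorem coe_frac (t : UnitAddCircle) : ((frac t : ℝ) : UnitAddCircle) = t :=
  AddCircle.coe_equivIco

theorem proj_flow (μ ν : ℝ) (k : ℤ) (u : Cylinder) :
    proj (flow μ ν k u) = rotation μ ν k (proj u) := by
  simp [proj, flow, rotation]

theorem exp_two_pi_I_mul_int_mul (a : ℂ) (n : ℤ) :
    Complex.exp (2 * Real.pi * Complex.I * (a + n)) =
      Complex.exp (2 * Real.pi * Complex.I * a) := by
  rw [mul_add, Complex.exp_add, mul_comm _ (n : ℂ), Complex.exp_int_mul_two_pi_mul_I, mul_one]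

/-- Comparing exponents, `z` cancels and `x` survives only with the integer coefficient `l c N`,
where `N = 2kν + {y} - {y + 2kν}`. The quotient of the two sides is thus 1-periodic in `x` and
descends to `𝕋²`. -/
theorem phase_mul_phase_flow (c : ℤ) (μ ν : ℝ) (k l : ℤ) (u : Cylinder) :
    phase c k u * phase c l (flow μ ν k u) =
      phase c (k + l) u * cocycle c μ ν k l (proj u) := by
  obtain ⟨x, y, z⟩ := u
  obtain ⟨N, hN⟩ : ∃ N : ℤ, 2 * k * ν + frac y -
      frac (y + ((2 * k * ν : ℝ) : UnitAddCircle)) = N := by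
    refine ⟨⌊frac y + 2 * k * ν⌋, ?_⟩
    have : frac (y + ((2 * k * ν : ℝ) : UnitAddCircle)) = Int.fract (frac y + 2 * k * ν) := by
      rw [← frac_coe, AddCircle.coe_add, coe_frac]
    rw [this, Int.fract]
    ring
  induction z using QuotientAddGroup.induction_on with | _ z
  simp only [phase, flow, cocycle, proj, frac_coe]
  have e : frac (y + ((2 * k * ν : ℝ) : UnitAddCircle)) = 2 * k * ν + frac y - N := by
    rw [← hN]; ring
  rw [e, ← AddCircle.coe_add]
  simp only [fourier_one_coe, ← Complex.exp_add, ← mul_neg, ← mul_add]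
  -- This integer is the change of exponent when `x` is replaced by its fractional part in the
  -- cocycle.
  rw [← exp_two_pi_I_mul_int_mul _ (-(l * c * N * ⌊x⌋))]
  congr 2
  have hx : Int.fract x = x - ⌊x⌋ := rfl
  rw [hx]
  push_cast
  ring

/-- For unimodular numbers conjugation is inversion, so this is the product rule in degrees `-k` and
`k`, whose product has the trivial phase of degree `0`. -/
theorem star_phase_flow (c : ℤ) (μ ν : ℝ) (k : ℤ) (u : Cylinder) :
    star (phase c k (flow μ ν (-k) u)) =
      phase c (-k) u * star (cocycle c μ ν (-k) k (proj u)) := by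
  have h := phase_mul_phase_flow c μ ν (-k) k u
  rw [neg_add_cancel, phase_zero, one_mul] at h
  have h1 : phase c k (flow μ ν (-k) u) * star (phase c k (flow μ ν (-k) u)) = 1 := by
    rw [RCLike.star_def, Complex.mul_conj, Complex.normSq_eq_norm_sq, norm_phase]
    norm_num
  have h2 : phase c (-k) u * star (phase c (-k) u) = 1 := by
    rw [RCLike.star_def, Complex.mul_conj, Complex.normSq_eq_norm_sq, norm_phase]
    norm_num
  rw [← h, star_mul]
  linear_combination (-star (phase c k (flow μ ν (-k) u))) * h2

/-- The function `e^{2πikcz} e^{-2πikcx{y}} h(x, y)` of degree `k`. -/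
def sectionFun (c k : ℤ) (h : UnitAddCircle × UnitAddCircle → ℂ) (u : Cylinder) : ℂ :=
  phase c k u * h (proj u)

theorem measurable_sectionFun (c k : ℤ) {h : UnitAddCircle × UnitAddCircle → ℂ}
    (hh : Measurable h) : Measurable (sectionFun c k h) :=
  (measurable_phase c k).mul (hh.comp measurable_proj)

theorem norm_sectionFun (c k : ℤ) (h : UnitAddCircle × UnitAddCircle → ℂ) (u : Cylinder) :
    ‖sectionFun c k h u‖ = ‖h (proj u)‖ := by
  rw [sectionFun, norm_mul, norm_phase, one_mul]

theorem memLp_sectionFun (c k : ℤ) {h : UnitAddCircle × UnitAddCircle → ℂ}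
    (hh : Measurable h) {C : ℝ} (hC : ∀ w, ‖h w‖ ≤ C) :
    MemLp (sectionFun c k h) ∞ (volume : Measure Cylinder) :=
  memLp_top_of_bound (measurable_sectionFun c k hh).aestronglyMeasurable C
    (Filter.Eventually.of_forall fun u => by rw [norm_sectionFun]; exact hC _)

theorem sectionFun_mul_sectionFun_flow (c : ℤ) (μ ν : ℝ) (k l : ℤ)
    (h h' : UnitAddCircle × UnitAddCircle → ℂ) (u : Cylinder) :
    sectionFun c k h u * sectionFun c l h' (flow μ ν k u) = sectionFun c (k + l)
      (fun w => cocycle c μ ν k l w * h w * h' (rotation μ ν k w)) u := by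
  simp only [sectionFun, proj_flow]
  linear_combination h (proj u) * h' (rotation μ ν k (proj u)) * phase_mul_phase_flow c μ ν k l u

theorem star_sectionFun_flow (c : ℤ) (μ ν : ℝ) (k : ℤ)
    (h : UnitAddCircle × UnitAddCircle → ℂ) (u : Cylinder) :
    star (sectionFun c k h (flow μ ν (-k) u)) = sectionFun c (-k)
      (fun w => star (cocycle c μ ν (-k) k w) * star (h (rotation μ ν (-k) w))) u := by
  simp only [sectionFun, proj_flow, star_mul, star_phase_flow]
  ring

theorem star_isTwistedBy_sectionFun {c : ℤ} {μ ν : ℝ} {k : ℤ}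
    {h : UnitAddCircle × UnitAddCircle → ℂ} {T : H →L[ℂ] H}
    (hT : IsTwistedBy μ ν k (sectionFun c k h) T) (hh : Measurable h) {C : ℝ}
    (hC : ∀ w, ‖h w‖ ≤ C) :
    IsTwistedBy μ ν (-k) (sectionFun c (-k) fun w =>
      star (cocycle c μ ν (-k) k w) * star (h (rotation μ ν (-k) w))) (star T) :=
  (hT.star (measurable_sectionFun c k hh)
    (fun u => by rw [norm_sectionFun]; exact hC _)).congr
    fun u => star_sectionFun_flow c μ ν k h u

/-! ### The isometries `L²(𝕋²) → L²(ℝ × 𝕋²)` -/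

/-- The translate of the unit cell by the inverse flow. -/
def cell (μ : ℝ) (k : ℤ) : Set Cylinder := Icc (-(2 * k * μ)) (-(2 * k * μ) + 1) ×ˢ univ

theorem measurableSet_cell (μ : ℝ) (k : ℤ) : MeasurableSet (cell μ k) :=
  measurableSet_Icc.prod MeasurableSet.univ

theorem flow_mem_cell (μ ν : ℝ) (k l : ℤ) (u : Cylinder) :
    flow μ ν k u ∈ cell μ l ↔ u ∈ cell μ (k + l) := by
  simp only [cell, flow, mem_prod, mem_Icc, mem_univ, and_true]
  push_cast
  constructor <;> rintro ⟨h1, h2⟩ <;> constructor <;> linarith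

instance : IsProbabilityMeasure (volume : Measure UnitAddCircle) := ⟨UnitAddCircle.measure_univ⟩

/-- In `x` the cell is exactly one period of the circle, and the `z`-circle that is projected away
has mass one. -/
theorem measurePreserving_proj (μ : ℝ) (k : ℤ) :
    MeasurePreserving proj ((volume : Measure Cylinder).restrict (cell μ k)) volume := by
  have h1 := UnitAddCircle.measurePreserving_mk (-(2 * k * μ))
  rw [Measure.restrict_congr_set Ioc_ae_eq_Icc] at h1
  have h2 : MeasurePreserving (Prod.fst : UnitAddCircle × UnitAddCircle → UnitAddCircle)
      volume volume := measurePreserving_fst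
  have h3 := h1.prod h2
  rwa [cell, Measure.volume_eq_prod, ← Measure.prod_restrict, Measure.restrict_univ]

/-- The isometry `h ↦ e^{2πikcz} e^{-2πikcx{y}} h(x, y) χ(x + 2kμ)`, where `χ` is the indicator
function of `[0, 1]`. -/
def sectionIsometry (c : ℤ) (μ : ℝ) (k : ℤ) :
    Lp ℂ 2 (volume : Measure (UnitAddCircle × UnitAddCircle)) →ₗᵢ[ℂ] H :=
  weightedComp (measurable_phase c k) (norm_phase c k) (measurableSet_cell μ k)
    (measurePreserving_proj μ k)

theorem coeFn_sectionIsometry (c : ℤ) (μ : ℝ) (k : ℤ) {h : UnitAddCircle × UnitAddCircle → ℂ}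
    (hh : MemLp h 2) :
    (sectionIsometry c μ k hh.toLp : Cylinder → ℂ) =ᵐ[volume]
      (cell μ k).indicator (sectionFun c k h) :=
  weightedComp_toLp _ _ _ _ hh

/-- Cells and phases both shift additively under the flow, so an operator of degree `k` maps the
`l`-th copy of `L²(𝕋²)` to the `(k + l)`-th one, acting as a weighted rotation. -/
theorem IsTwistedBy.apply_sectionIsometry {c : ℤ} {μ ν : ℝ} {k : ℤ}
    {h : UnitAddCircle × UnitAddCircle → ℂ} {T : H →L[ℂ] H}
    (hT : IsTwistedBy μ ν k (sectionFun c k h) T) (l : ℤ)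
    {h' : UnitAddCircle × UnitAddCircle → ℂ} (hh' : MemLp h' 2)
    (hm : MemLp (fun w => cocycle c μ ν k l w * h w * h' (rotation μ ν k w)) 2) :
    T (sectionIsometry c μ l hh'.toLp) = sectionIsometry c μ (k + l) hm.toLp := by
  refine Lp.ext ((hT _).trans (Filter.EventuallyEq.trans ?_
    (coeFn_sectionIsometry c μ (k + l) hm).symm))
  have h1 := (measurePreserving_flow μ ν k).quasiMeasurePreserving.ae_eq_comp
    (coeFn_sectionIsometry c μ l hh')
  filter_upwards [h1] with u h1
  simp only [Function.comp_apply] at h1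
  rw [h1]
  by_cases hu : u ∈ cell μ (k + l)
  · rw [indicator_of_mem hu, indicator_of_mem ((flow_mem_cell μ ν k l u).2 hu),
      sectionFun_mul_sectionFun_flow]
  · rw [indicator_of_notMem hu, indicator_of_notMem (mt (flow_mem_cell μ ν k l u).1 hu), mul_zero]

/-- `χ ∘ θ_k` is the indicator of the `k`-th cell. Through this formula, statements about operators
of degree `k` become statements about functions on the torus. -/
theorem IsTwistedBy.apply_cellVector {c : ℤ} {μ ν : ℝ} {k : ℤ}
    {h : UnitAddCircle × UnitAddCircle → ℂ} {T : H →L[ℂ] H}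
    (hT : IsTwistedBy μ ν k (sectionFun c k h) T) (hh : MemLp h 2) :
    T cellVector = sectionIsometry c μ k hh.toLp := by
  refine Lp.ext ((hT _).trans (Filter.EventuallyEq.trans ?_
    (coeFn_sectionIsometry c μ k hh).symm))
  have h0 : (cellVector : Cylinder → ℂ) =ᵐ[volume] (cell μ 0).indicator fun _ => 1 := by
    rw [show cell μ 0 = Icc (0 : ℝ) 1 ×ˢ univ by simp [cell]]
    exact indicatorConstLp_coeFn
  have h1 := (measurePreserving_flow μ ν k).quasiMeasurePreserving.ae_eq_comp h0
  filter_upwards [h1] with u h1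
  simp only [Function.comp_apply] at h1
  rw [h1]
  have := flow_mem_cell μ ν k 0 u
  rw [add_zero] at this
  by_cases hu : u ∈ cell μ k
  · rw [indicator_of_mem hu, indicator_of_mem (this.2 hu), mul_one]
  · rw [indicator_of_notMem hu, indicator_of_notMem (mt this.1 hu), mul_zero]

theorem measurePreserving_rotation (μ ν : ℝ) (k : ℤ) : MeasurePreserving (rotation μ ν k) :=
  (measurePreserving_add_right (volume : Measure UnitAddCircle) _).prod
    (measurePreserving_add_right (volume : Measure UnitAddCircle) _)

theorem memLp_mul_rotation (c : ℤ) (μ ν : ℝ) (k l : ℤ)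
    {h h' : UnitAddCircle × UnitAddCircle → ℂ} (hh : Measurable h) {C : ℝ} (hC : ∀ w, ‖h w‖ ≤ C)
    (hh' : MemLp h' 2) :
    MemLp (fun w => cocycle c μ ν k l w * h w * h' (rotation μ ν k w)) 2 := by
  have h1 : MemLp (h' ∘ rotation μ ν k) 2 :=
    hh'.comp_measurePreserving (measurePreserving_rotation μ ν k)
  refine h1.of_le_mul (c := C)
    (((measurable_cocycle c μ ν k l).mul hh).aestronglyMeasurable.mul h1.1)
    (Filter.Eventually.of_forall fun w => ?_)
  simp only [norm_mul, norm_cocycle, one_mul, Function.comp_apply]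
  gcongr
  exact hC w

/-! ### Strong approximation by elements of the spectral subspaces -/

/-- Dominated convergence for the integral giving `‖T n ξ - S ξ‖²`, with majorant `C² |ξ ∘ θ_k|²`.
-/
theorem tendsto_of_isTwistedBy {μ ν : ℝ} {k : ℤ} {g : ℕ → Cylinder → ℂ} {g' : Cylinder → ℂ}
    {T : ℕ → H →L[ℂ] H} {S : H →L[ℂ] H} (hT : ∀ n, IsTwistedBy μ ν k (g n) (T n))
    (hS : IsTwistedBy μ ν k g' S) {C : ℝ} (hC : ∀ n u, ‖g n u - g' u‖ ≤ C)
    (hg : ∀ᵐ u, Tendsto (fun n => g n u) atTop (𝓝 (g' u))) (ξ : H) :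
    Tendsto (fun n => T n ξ) atTop (𝓝 (S ξ)) := by
  have hξ : MemLp (fun u => ξ (flow μ ν k u)) 2 (volume : Measure Cylinder) :=
    (Lp.memLp ξ).comp_measurePreserving (measurePreserving_flow μ ν k)
  have hd : ∀ n, ((T n ξ - S ξ : H) : Cylinder → ℂ) =ᵐ[volume]
      fun u => (g n u - g' u) * ξ (flow μ ν k u) := fun n => by
    filter_upwards [Lp.coeFn_sub (T n ξ) (S ξ), hT n ξ, hS ξ] with u h1 h2 h3
    rw [h1, Pi.sub_apply, h2, h3, sub_mul]
  have hlim : Tendsto (fun n => inner ℂ (T n ξ - S ξ) (T n ξ - S ξ)) atTop (𝓝 0) := by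
    simp only [L2.inner_def]
    rw [← integral_zero Cylinder ℂ]
    refine tendsto_integral_of_dominated_convergence
      (fun u => C ^ 2 * ‖ξ (flow μ ν k u)‖ ^ 2)
      (fun n => (Lp.aestronglyMeasurable _).inner (Lp.aestronglyMeasurable _))
      (((memLp_two_iff_integrable_sq_norm hξ.1).1 hξ).const_mul _) ?_ ?_
    · intro n
      filter_upwards [hd n] with u h1
      rw [h1, inner_self_eq_norm_sq_to_K]
      simp only [norm_mul, norm_pow, RCLike.norm_ofReal, abs_norm, mul_pow, abs_mul]
      gcongr
      exact hC n u
    · filter_upwards [ae_all_iff.2 hd, hg] with u h1 h2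
      simp only [h1]
      have h3 : Tendsto (fun n => (g n u - g' u) * ξ (flow μ ν k u)) atTop (𝓝 0) := by
        have := (h2.sub_const (g' u)).mul_const (ξ (flow μ ν k u))
        rwa [sub_self, zero_mul] at this
      have := h3.inner (𝕜 := ℂ) h3
      rwa [inner_zero_left] at this
  rw [tendsto_iff_norm_sub_tendsto_zero]
  have h2 : Tendsto (fun n => ‖T n ξ - S ξ‖ ^ 2) atTop (𝓝 0) := by
    have := hlim.norm
    simpa [inner_self_eq_norm_sq_to_K] using this
  have := h2.sqrt
  simpa using this

/-- The phase is discontinuous only through `{y}`, that is, at `y = 0`; being unimodular, it does no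
harm where `φ` vanishes. -/
theorem continuous_sectionFun (c k : ℤ) {φ : UnitAddCircle × UnitAddCircle → ℂ}
    (hφ : Continuous φ) (h0 : ∀ x, φ (x, 0) = 0) : Continuous (sectionFun c k φ) := by
  have hc := hφ.comp continuous_proj
  refine continuous_iff_continuousAt.2 fun u => ?_
  by_cases hu : u.2.1 = 0
  · have hz : sectionFun c k φ u = 0 := by
      rw [sectionFun, show proj u = ((u.1 : UnitAddCircle), 0) by rw [← hu]; rfl, h0, mul_zero]
    have hz' : φ (proj u) = 0 := by
      rw [show proj u = ((u.1 : UnitAddCircle), 0) by rw [← hu]; rfl, h0]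
    rw [ContinuousAt, hz, tendsto_zero_iff_norm_tendsto_zero]
    simp only [norm_sectionFun]
    have := hc.norm.tendsto u
    rwa [Function.comp_apply, hz', norm_zero] at this
  · have h1 : ContinuousAt (fun u : Cylinder => frac u.2.1) u := by
      have : ContinuousAt frac u.2.1 :=
        continuous_subtype_val.continuousAt.comp
          (AddCircle.continuousAt_equivIco 1 0 (by simpa using hu))
      exact ContinuousAt.comp (f := fun u : Cylinder => u.2.1) this
        (continuous_fst.comp continuous_snd).continuousAt
    have h1' : ContinuousAt (fun u : Cylinder => ((frac u.2.1 : ℝ) : ℂ)) u :=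
      Complex.continuous_ofReal.continuousAt.comp h1
    have h2 : ContinuousAt (fun u : Cylinder => (fourier (k * c) u.2.2 : ℂ)) u :=
      ((fourier (k * c)).continuous.comp (continuous_snd.comp continuous_snd)).continuousAt
    have h3 : ContinuousAt (fun u : Cylinder => (u.1 : ℂ)) u :=
      (Complex.continuous_ofReal.comp continuous_fst).continuousAt
    refine ContinuousAt.mul (h2.mul ?_) hc.continuousAt
    exact Complex.continuous_exp.continuousAt.comp
      ((continuousAt_const.mul ((continuousAt_const.mul h3).mul h1')).neg)

/-- A section of degree `k` over `𝕋²` that vanishes on the circle `y = 0`, as an element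
of `B_k`. -/
theorem exists_spectral_eq_sectionFun {c : ℤ} (hc : c ≠ 0) (k : ℤ)
    {φ : UnitAddCircle × UnitAddCircle → ℂ} (hφ : Continuous φ) (h0 : ∀ x, φ (x, 0) = 0) :
    ∃ F : spectralSubspace c k, ∀ u, F.1 (toManifold c u) = sectionFun c k φ u := by
  have hcont : Continuous fun v : ℝ × ℝ × ℝ =>
      sectionFun c k φ (v.1, (v.2.1 : UnitAddCircle), (v.2.2 : UnitAddCircle)) := by
    have hm := AddCircle.continuous_mk' (1 : ℝ)
    exact (continuous_sectionFun c k hφ h0).comp (continuous_fst.prodMk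
      ((hm.comp (continuous_fst.comp continuous_snd)).prodMk
        (hm.comp (continuous_snd.comp continuous_snd))))
  have hinv : ∀ u v : ℝ × ℝ × ℝ, (heisenbergSetoid c).r u v →
      sectionFun c k φ (u.1, (u.2.1 : UnitAddCircle), (u.2.2 : UnitAddCircle)) =
        sectionFun c k φ (v.1, (v.2.1 : UnitAddCircle), (v.2.2 : UnitAddCircle)) := by
    rintro ⟨x, y, z⟩ _ ⟨m, n, p, ⟨q, hq⟩, rfl⟩
    have hp1 : ∀ (t : ℝ) (j : ℤ), ((t + j : ℝ) : UnitAddCircle) = t := fun t j => by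
      have : ((j : ℝ) : UnitAddCircle) = 0 := (AddCircle.coe_eq_zero_iff (1 : ℝ)).2 ⟨j, by simp⟩
      rw [AddCircle.coe_add, this, add_zero]
    simp only [sectionFun, proj, hp1, phase, fourier_one_coe, frac_coe]
    congr 1
    simp only [← Complex.exp_add, ← mul_neg, ← mul_add]
    -- Translation by `(m, n, p)` changes the exponent by `k(cp) + kcm(y - {y})`, which is this
    -- integer.
    rw [← exp_two_pi_I_mul_int_mul _ (k * q + k * c * m * ⌊y⌋)]
    congr 2
    have hy : Int.fract y = y - ⌊y⌋ := rfl
    have hq' : (c : ℂ) * p = q := by exact_mod_cast hq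
    rw [hy]
    push_cast
    linear_combination (-(k : ℂ)) * hq'
  let F : C(HeisenbergManifold c, ℂ) :=
    ⟨Quotient.lift (s := heisenbergSetoid c) _ hinv,
      hcont.quotient_lift (s := heisenbergSetoid c) hinv⟩
  refine ⟨⟨F, ?_⟩, ?_⟩
  · intro t a
    obtain ⟨⟨x, y, z⟩, rfl⟩ := Quotient.exists_rep a
    change sectionFun c k φ (x, (y : UnitAddCircle), ((z + t / c : ℝ) : UnitAddCircle)) =
      _ * sectionFun c k φ (x, (y : UnitAddCircle), (z : UnitAddCircle))
    have hc' : (c : ℂ) ≠ 0 := by exact_mod_cast hc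
    simp only [sectionFun, proj, phase, fourier_one_coe]
    rw [← mul_assoc (Complex.exp (2 * Real.pi * Complex.I * k * t))]
    congr 1
    rw [← Complex.exp_add, ← Complex.exp_add, ← Complex.exp_add]
    congr 1
    push_cast
    field_simp
    ring
  · rintro ⟨x, y, z⟩
    induction y using QuotientAddGroup.induction_on with | _ y
    induction z using QuotientAddGroup.induction_on with | _ z
    rfl

/-- A continuous cut-off function on `𝕋²` vanishing on the circle `y = 0`. -/
def cutoff (n : ℕ) (w : UnitAddCircle × UnitAddCircle) : ℂ := ((min 1 (n * ‖w.2‖) : ℝ) : ℂ)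

theorem continuous_cutoff (n : ℕ) : Continuous (cutoff n) := by
  unfold cutoff
  fun_prop

theorem norm_one_sub_cutoff_le (n : ℕ) (w : UnitAddCircle × UnitAddCircle) :
    ‖cutoff n w - 1‖ ≤ 1 := by
  have h0 : 0 ≤ min 1 ((n : ℝ) * ‖w.2‖) := le_min zero_le_one (by positivity)
  have h1 : min 1 ((n : ℝ) * ‖w.2‖) ≤ 1 := min_le_left _ _
  rw [cutoff, ← Complex.ofReal_one, ← Complex.ofReal_sub, Complex.norm_real, Real.norm_eq_abs,
    abs_le]
  constructor <;> linarith

theorem tendsto_cutoff {w : UnitAddCircle × UnitAddCircle} (hw : w.2 ≠ 0) :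
    Tendsto (fun n => cutoff n w) atTop (𝓝 1) := by
  have h : Tendsto (fun n : ℕ => (n : ℝ) * ‖w.2‖) atTop atTop :=
    tendsto_natCast_atTop_atTop.atTop_mul_const (norm_pos_iff.2 hw)
  refine tendsto_const_nhds.congr' ?_
  filter_upwards [h.eventually_ge_atTop 1] with n hn
  rw [cutoff, min_eq_left hn, Complex.ofReal_one]

/-- The circle `y = 0` is the only place where the cut-offs fail to tend to one. -/
theorem ae_ne_zero : ∀ᵐ u : Cylinder, u.2.1 ≠ 0 := by
  have h : ∀ᵐ y : UnitAddCircle, y ≠ 0 := by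
    refine compl_mem_ae_iff.2 ?_
    change volume ({0} : Set UnitAddCircle) = 0
    have := (UnitAddCircle.measurePreserving_mk 0).measure_preimage
      (measurableSet_singleton (0 : UnitAddCircle)).nullMeasurableSet
    rw [← this, Measure.restrict_apply
      (AddCircle.measurable_mk' (measurableSet_singleton _))]
    refine measure_mono_null (t := range fun n : ℤ => (n : ℝ)) ?_ ((countable_range _).measure_zero _)
    rintro x ⟨hx, -⟩
    obtain ⟨n, hn⟩ := (AddCircle.coe_eq_zero_iff (1 : ℝ)).1 hx
    exact ⟨n, by simpa using hn⟩
  have h1 : Measure.QuasiMeasurePreserving (fun u : Cylinder => u.2.1) volume volume :=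
    Measure.quasiMeasurePreserving_fst.comp Measure.quasiMeasurePreserving_snd
  exact h1.ae h

theorem toOperator_ofSpectral (c : ℤ) (μ ν : ℝ) (k : ℤ) (F : spectralSubspace c k) :
    IsTwistedBy μ ν k (fun u => F.1 (toManifold c u))
      (toOperator c μ ν (ofSpectral c μ ν k F)) :=
  isTwistedBy_twistedMul μ ν k _

/-- The operator of a continuous function on `𝕋²` in degree `k` is a strong limit of elements
of `B_k`. -/
theorem exists_spectral_tendsto {c : ℤ} (hc : c ≠ 0) {μ ν : ℝ} {k : ℤ}
    {e : UnitAddCircle × UnitAddCircle → ℂ} (he : Continuous e) {C : ℝ} (hC : ∀ w, ‖e w‖ ≤ C)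
    {T : H →L[ℂ] H} (hT : IsTwistedBy μ ν k (sectionFun c k e) T) :
    ∃ F : ℕ → spectralSubspace c k, ∀ ξ,
      Tendsto (fun n => toOperator c μ ν (ofSpectral c μ ν k (F n)) ξ) atTop (𝓝 (T ξ)) := by
  choose F hF using fun n => exists_spectral_eq_sectionFun hc k
    (φ := fun w => cutoff n w * e w) ((continuous_cutoff n).mul he)
    (fun x => by simp [cutoff])
  refine ⟨F, fun ξ => tendsto_of_isTwistedBy (C := C)
    (fun n => (toOperator_ofSpectral c μ ν k (F n)).congr (hF n)) hT (fun n u => ?_) ?_ ξ⟩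
  · have : sectionFun c k (fun w => cutoff n w * e w) u - sectionFun c k e u =
        phase c k u * (cutoff n (proj u) - 1) * e (proj u) := by
      simp only [sectionFun]
      ring
    rw [this, norm_mul, norm_mul, norm_phase, one_mul]
    calc _ ≤ 1 * ‖e (proj u)‖ := by gcongr; exact norm_one_sub_cutoff_le n _
      _ ≤ C := by rw [one_mul]; exact hC _
  · filter_upwards [ae_ne_zero] with u hu
    have := ((tendsto_cutoff (w := proj u) hu).mul_const (e (proj u))).const_mul (phase c k u)
    rwa [one_mul] at this

/-! ### The generated von Neumann algebra -/

/-- Commutation with a fixed bounded operator survives strong limits, so a bicommutant contains the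
strong limits of sequences from the algebra. -/
theorem mem_vonNeumann_of_tendsto {c : ℤ} {μ ν : ℝ} {a : ℕ → QuantumHeisenberg c μ ν}
    {T : H →L[ℂ] H}
    (h : ∀ ξ, Tendsto (fun n => toOperator c μ ν (a n) ξ) atTop (𝓝 (T ξ))) :
    T ∈ vonNeumann c μ ν := by
  intro S hS
  ext ξ : 1
  have h1 := h (S ξ)
  have h2 := (S.continuous.tendsto _).comp (h ξ)
  refine tendsto_nhds_unique h2 (h1.congr fun n => ?_)
  exact congrArg (fun R : H →L[ℂ] H => R ξ) (hS (toOperator c μ ν (a n)) (a n).2)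

theorem mul_mem_vonNeumann {c : ℤ} {μ ν : ℝ} {S T : H →L[ℂ] H} (hS : S ∈ vonNeumann c μ ν)
    (hT : T ∈ vonNeumann c μ ν) : S * T ∈ vonNeumann c μ ν :=
  Set.mul_mem_centralizer hS hT

theorem star_mem_vonNeumann {c : ℤ} {μ ν : ℝ} {T : H →L[ℂ] H} (hT : T ∈ vonNeumann c μ ν) :
    star T ∈ vonNeumann c μ ν :=
  Set.star_mem_centralizer' (fun _ h => Set.star_mem_centralizer' (fun _ h => star_mem h) h) hT

theorem one_mem_vonNeumann (c : ℤ) (μ ν : ℝ) : 1 ∈ vonNeumann c μ ν :=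
  Set.one_mem_centralizer

theorem intPow_induction {P : ℤ → (H →L[ℂ] H) → Prop} {T : H →L[ℂ] H} (h0 : P 0 1)
    (h1 : ∀ n S, P n S → P (n + 1) (S * T)) (h2 : ∀ n S, P n S → P (n - 1) (S * star T))
    (n : ℤ) : P n (intPow T n) := by
  cases n with
  | ofNat n =>
    change P n (T ^ n)
    induction n with
    | zero => simpa using h0
    | succ n ih =>
      rw [pow_succ]
      exact_mod_cast h1 _ _ ih
  | negSucc n =>
    -- Induction over all `j ≥ 0` reaches back to the base case `P 0 1`; `negSucc n` is the case `j
    -- = n + 1`.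
    have : ∀ j : ℕ, P (-j) (star T ^ j) := fun j => by
      induction j with
      | zero => simpa using h0
      | succ j ih =>
        rw [pow_succ]
        have := h2 _ _ ih
        rwa [show (-(j : ℤ) - 1) = -((j + 1 : ℕ) : ℤ) by push_cast; ring] at this
    exact this (n + 1)

theorem intPow_mem_vonNeumann {c : ℤ} {μ ν : ℝ} {T : H →L[ℂ] H} (hT : T ∈ vonNeumann c μ ν)
    (n : ℤ) : intPow T n ∈ vonNeumann c μ ν :=
  intPow_induction (P := fun _ S => S ∈ vonNeumann c μ ν) (one_mem_vonNeumann c μ ν)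
    (fun _ _ hS => mul_mem_vonNeumann hS hT)
    (fun _ _ hS => mul_mem_vonNeumann hS (star_mem_vonNeumann hT)) n

/-! ### The generators `U`, `V`, `W` as sections with continuous weights on the torus -/

theorem isTwistedBy_U (c : ℤ) (μ ν : ℝ) :
    IsTwistedBy μ ν 0 (sectionFun c 0 fun w => fourier 1 w.1) (U μ ν) :=
  (isTwistedBy_twistedMul μ ν 0 memLp_funU).congr fun u => by
    simp only [funU, sectionFun, phase_zero, proj, fourier_one_coe, Int.cast_one, one_mul]

theorem isTwistedBy_V (c : ℤ) (μ ν : ℝ) :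
    IsTwistedBy μ ν 0 (sectionFun c 0 fun w => fourier 1 w.2) (V μ ν) :=
  (isTwistedBy_twistedMul μ ν 0 memLp_funV).congr fun u => by
    simp [funV, sectionFun, phase_zero, proj]

theorem isTwistedBy_W (c : ℤ) (μ ν : ℝ) :
    IsTwistedBy μ ν 1 (sectionFun c 1 fun _ => 1) (W c μ ν) :=
  (isTwistedBy_twistedMul μ ν 1 (memLp_funW c)).congr fun u => by
    simp [funW, sectionFun, phase, mul_assoc]

theorem mem_vonNeumann_of_isTwistedBy {c : ℤ} (hc : c ≠ 0) {μ ν : ℝ} {k : ℤ}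
    {e : UnitAddCircle × UnitAddCircle → ℂ} (he : Continuous e) {C : ℝ} (hC : ∀ w, ‖e w‖ ≤ C)
    {T : H →L[ℂ] H} (hT : IsTwistedBy μ ν k (sectionFun c k e) T) : T ∈ vonNeumann c μ ν := by
  obtain ⟨F, hF⟩ := exists_spectral_tendsto hc he hC hT
  exact mem_vonNeumann_of_tendsto hF

theorem monomial_mem_vonNeumann {c : ℤ} (hc : c ≠ 0) (μ ν : ℝ) (m n k : ℤ) :
    monomial c μ ν m n k ∈ vonNeumann c μ ν := by
  refine mul_mem_vonNeumann (mul_mem_vonNeumann ?_ ?_) ?_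
  · exact intPow_mem_vonNeumann (mem_vonNeumann_of_isTwistedBy hc (C := 1) (by fun_prop)
      (fun w => (norm_fourier_apply _ _).le) (isTwistedBy_U c μ ν)) m
  · exact intPow_mem_vonNeumann (mem_vonNeumann_of_isTwistedBy hc (C := 1) (by fun_prop)
      (fun w => (norm_fourier_apply _ _).le) (isTwistedBy_V c μ ν)) n
  · exact intPow_mem_vonNeumann (mem_vonNeumann_of_isTwistedBy hc (C := 1) (by fun_prop)
      (fun w => by simp) (isTwistedBy_W c μ ν)) k

/-! ### Orthonormal bases of `L²(𝕋²)` -/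

theorem exists_hilbertBasis_of_isometryEquiv {ι ι' E E' : Type*} [NormedAddCommGroup E]
    [InnerProductSpace ℂ E] [NormedAddCommGroup E'] [InnerProductSpace ℂ E'] [CompleteSpace E']
    (e : ι' ≃ ι) (b : HilbertBasis ι ℂ E) (A : E ≃ₗᵢ[ℂ] E') :
    ∃ b' : HilbertBasis ι' ℂ E', ∀ i, b' i = A (b (e i)) := by
  have ho : Orthonormal ℂ fun i => A (b (e i)) :=
    (b.orthonormal.comp e e.injective).comp_linearIsometryEquiv A
  refine ⟨HilbertBasis.mk ho ?_, fun i => by rw [HilbertBasis.coe_mk]⟩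
  have hr : range (fun i => A (b (e i))) = A '' range b := by
    rw [← range_comp, ← e.surjective.range_comp (A ∘ b)]
    rfl
  have h := A.surjective.denseRange.topologicalClosure_map_submodule
    (f := (A.toContinuousLinearEquiv : E →L[ℂ] E')) b.dense_span
  rw [hr]
  refine h.ge.trans (le_of_eq ?_)
  congr 1
  exact Submodule.map_span _ _

theorem volume_torus : (volume : Measure (UnitAddCircle × UnitAddCircle)) =
    AddCircle.haarAddCircle.prod AddCircle.haarAddCircle := by
  have h : (volume : Measure UnitAddCircle) = AddCircle.haarAddCircle := by
    rw [AddCircle.volume_eq_smul_haarAddCircle]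
    simp
  rw [Measure.volume_eq_prod, h]

theorem conj_mul_of_norm_one {z : ℂ} (hz : ‖z‖ = 1) : z * star z = 1 := by
  rw [RCLike.star_def, Complex.mul_conj, Complex.normSq_eq_norm_sq, hz]
  norm_num

theorem memLp_two_of_bound {h : UnitAddCircle × UnitAddCircle → ℂ} (hh : Measurable h) {C : ℝ}
    (hC : ∀ w, ‖h w‖ ≤ C) : MemLp h 2 :=
  MemLp.of_bound hh.aestronglyMeasurable C (Eventually.of_forall hC)

/-- The function `e^{2πi(mx+ny)} ω(x, y)` on `𝕋²`. -/
def character (ω : UnitAddCircle × UnitAddCircle → ℂ) (m n : ℤ)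
    (w : UnitAddCircle × UnitAddCircle) : ℂ :=
  fourier m w.1 * fourier n w.2 * ω w

theorem measurable_character {ω : UnitAddCircle × UnitAddCircle → ℂ} (hω : Measurable ω)
    (m n : ℤ) : Measurable (character ω m n) := by
  unfold character
  fun_prop

theorem norm_character {ω : UnitAddCircle × UnitAddCircle → ℂ} (hω : ∀ w, ‖ω w‖ = 1)
    (m n : ℤ) (w : UnitAddCircle × UnitAddCircle) : ‖character ω m n w‖ = 1 := by
  rw [character, norm_mul, norm_mul, norm_fourier_apply, norm_fourier_apply, hω]
  norm_num

theorem memLp_character {ω : UnitAddCircle × UnitAddCircle → ℂ} (hω : Measurable ω)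
    (hω1 : ∀ w, ‖ω w‖ = 1) (m n : ℤ) : MemLp (character ω m n) 2 :=
  memLp_two_of_bound (measurable_character hω m n) fun w => (norm_character hω1 m n w).le

/-- Multiplication by a unimodular function is unitary, so it carries the Fourier basis to a basis.
The operator `A` combines it with the identification of `Fin 2 → 𝕋` with `𝕋 × 𝕋`, on whose first
form `UnitAddTorus.mFourierBasis` lives. -/
theorem exists_hilbertBasis_character {ω : UnitAddCircle × UnitAddCircle → ℂ}
    (hω : Measurable ω) (hω1 : ∀ w, ‖ω w‖ = 1) :
    ∃ b : HilbertBasis (ℤ × ℤ) ℂ (Lp ℂ 2 (volume : Measure (UnitAddCircle × UnitAddCircle))),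
      ∀ m n, b (m, n) = (memLp_character hω hω1 m n).toLp := by
  let P : Measure (Fin 2 → UnitAddCircle) := Measure.pi fun _ => AddCircle.haarAddCircle
  let q : (Fin 2 → UnitAddCircle) ≃ᵐ UnitAddCircle × UnitAddCircle := MeasurableEquiv.finTwoArrow
  have hq : MeasurePreserving q P volume := by
    rw [volume_torus]
    exact measurePreserving_finTwoArrow _
  have hq' : MeasurePreserving q.symm (volume.restrict univ) P := by
    rw [Measure.restrict_univ]
    exact hq.symm q
  have hqr : MeasurePreserving q (P.restrict univ) volume := by
    rwa [Measure.restrict_univ]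
  have hσ : Measurable fun x => star (ω (q x)) :=
    continuous_star.measurable.comp (hω.comp q.measurable)
  have hσ1 : ∀ x, ‖star (ω (q x))‖ = 1 := fun x => by rw [norm_star, hω1]
  let A := weightedComp hω hω1 MeasurableSet.univ hq'
  -- The preimage of `h` is `h` times the conjugate of `ω`, transported back along `q`.
  have hA : Function.Surjective A := by
    intro h
    have hm := memLp_weightedComp hσ hσ1 MeasurableSet.univ hqr (Lp.memLp h)
    refine ⟨hm.toLp, Lp.ext ((weightedComp_toLp hω hω1 MeasurableSet.univ hq' hm).trans
      (Eventually.of_forall fun w => ?_))⟩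
    simp only [indicator_univ, MeasurableEquiv.apply_symm_apply]
    rw [← mul_assoc, conj_mul_of_norm_one (hω1 w), one_mul]
  let b₀ : HilbertBasis (Fin 2 → ℤ) ℂ (Lp ℂ 2 P) := UnitAddTorus.mFourierBasis
  obtain ⟨b, hb⟩ := exists_hilbertBasis_of_isometryEquiv (finTwoArrowEquiv ℤ).symm b₀
    (LinearIsometryEquiv.ofSurjective A hA)
  refine ⟨b, fun m n => ?_⟩
  rw [hb]
  have h1 : (b₀ ((finTwoArrowEquiv ℤ).symm (m, n)) : (Fin 2 → UnitAddCircle) → ℂ) =ᵐ[P]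
      UnitAddTorus.mFourier ![m, n] := by
    have : b₀ ((finTwoArrowEquiv ℤ).symm (m, n)) = UnitAddTorus.mFourierLp 2 ![m, n] := by
      change UnitAddTorus.mFourierBasis _ = _
      rw [UnitAddTorus.coe_mFourierBasis]
      rfl
    rw [this]
    exact UnitAddTorus.coeFn_mFourierLp 2 _
  change A (b₀ ((finTwoArrowEquiv ℤ).symm (m, n))) = _
  refine MemLp.toLp_congr (memLp_weightedComp hω hω1 MeasurableSet.univ hq' (Lp.memLp _)) _
    ((indicator_comp_ae_eq MeasurableSet.univ hq' ω h1).trans (Eventually.of_forall fun w => ?_))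
  simp only [indicator_univ, character]
  rw [mul_comm]
  congr 1
  simp [UnitAddTorus.mFourier, q, MeasurableEquiv.finTwoArrow]

/-! ### The GNS space as a space of functions on `ℝ × 𝕋²` -/

/-- This is what realises the GNS space inside `L²(ℝ × 𝕋²)`: the GNS inner product is that of the
vectors `aχ` and `bχ`. -/
theorem trace_star_mul (c : ℤ) (μ ν : ℝ) (a b : QuantumHeisenberg c μ ν) :
    trace c μ ν (star a * b) =
      inner ℂ (toOperator c μ ν a cellVector) (toOperator c μ ν b cellVector) := by
  change operatorTrace (toOperator c μ ν (star a * b)) = _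
  rw [map_mul, map_star, operatorTrace, ContinuousLinearMap.star_eq_adjoint, mul_apply_eq_comp,
    ContinuousLinearMap.adjoint_inner_right]

/-- The isometry `a ↦ a χ` of `D^c_{μν}` with the norm of the GNS space. -/
def preGNSIsometry (c : ℤ) (μ ν : ℝ) : (trace c μ ν).PreGNS →ₗᵢ[ℂ] H where
  toFun a := toOperator c μ ν ((trace c μ ν).ofPreGNS a) cellVector
  map_add' a b := by simp
  map_smul' r a := by simp
  norm_map' a := by
    have h := (trace c μ ν).preGNS_norm_sq a
    rw [trace_star_mul, inner_self_eq_norm_sq_to_K] at h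
    have h2 : ‖a‖ ^ 2 = ‖toOperator c μ ν ((trace c μ ν).ofPreGNS a) cellVector‖ ^ 2 := by
      apply Complex.ofReal_injective
      push_cast
      exact h
    exact ((sq_eq_sq₀ (norm_nonneg _) (norm_nonneg _)).1 h2).symm

/-- The isometry `L²(D^c_{μν}, τ) → L²(ℝ × 𝕋²)` with `a ↦ a χ` for `a` in `D^c_{μν}`. -/
def gnsIsometry (c : ℤ) (μ ν : ℝ) : L2 c μ ν →ₗᵢ[ℂ] H where
  toLinearMap := ((preGNSIsometry c μ ν).toContinuousLinearMap.extend
    (UniformSpace.Completion.toComplL (𝕜 := ℂ) (E := (trace c μ ν).PreGNS))).toLinearMap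
  norm_map' η := by
    induction η using UniformSpace.Completion.induction_on with
    | hp => exact isClosed_eq (ContinuousLinearMap.continuous _).norm continuous_norm
    | ih a =>
      have := ContinuousLinearMap.extend_eq (preGNSIsometry c μ ν).toContinuousLinearMap
        (e := UniformSpace.Completion.toComplL (𝕜 := ℂ) (E := (trace c μ ν).PreGNS))
        UniformSpace.Completion.denseRange_coe
        (UniformSpace.Completion.isUniformInducing_coe _) a
      refine (congrArg norm this).trans ?_
      rw [UniformSpace.Completion.norm_coe]
      exact (preGNSIsometry c μ ν).norm_map a

theorem gnsIsometry_toL2 (c : ℤ) (μ ν : ℝ) (a : QuantumHeisenberg c μ ν) :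
    gnsIsometry c μ ν (toL2 c μ ν a) = toOperator c μ ν a cellVector :=
  ContinuousLinearMap.extend_eq (preGNSIsometry c μ ν).toContinuousLinearMap
    (e := UniformSpace.Completion.toComplL (𝕜 := ℂ) (E := (trace c μ ν).PreGNS))
    UniformSpace.Completion.denseRange_coe (UniformSpace.Completion.isUniformInducing_coe _)
    ((trace c μ ν).toPreGNS a)

theorem denseRange_toL2 (c : ℤ) (μ ν : ℝ) : DenseRange (toL2 c μ ν) :=
  UniformSpace.Completion.denseRange_coe.comp (trace c μ ν).toPreGNS.surjective.denseRange
    (UniformSpace.Completion.continuous_coe _)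

/-- Each `τ(S* T)` is the inner product of `Sχ` and `Tχ`, so being the class of `T` reduces to one
identity of vectors in `L²(ℝ × 𝕋²)`. -/
theorem isClassOf_of_gnsIsometry_eq {c : ℤ} {μ ν : ℝ} {η : L2 c μ ν} {T : H →L[ℂ] H}
    (hT : T ∈ vonNeumann c μ ν) (h : gnsIsometry c μ ν η = T cellVector) :
    IsClassOf c μ ν η T := by
  have key : ∀ S : H →L[ℂ] H,
      operatorTrace (star S * T) = inner ℂ (S cellVector) (T cellVector) := fun S => by
    rw [operatorTrace, ContinuousLinearMap.star_eq_adjoint, mul_apply_eq_comp,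
      ContinuousLinearMap.adjoint_inner_right]
  refine ⟨hT, fun a => ?_, ?_⟩
  · rw [key, ← h, ← gnsIsometry_toL2, LinearIsometry.inner_map_map]
  · rw [key, ← h, LinearIsometry.inner_map_map]

/-! ### The completed spectral subspaces -/

/-- The function `e^{2πickx{y}} f(x, y)` on `𝕋²` attached to `F = e^{2πikcz} f(x, y)` in `B_k`. -/
def torusFun (c k : ℤ) (F : spectralSubspace c k) (w : UnitAddCircle × UnitAddCircle) : ℂ :=
  Complex.exp (2 * Real.pi * Complex.I * c * k * frac w.1 * frac w.2) *
    F.1 (HeisenbergManifold.mk c (frac w.1, frac w.2, 0))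

theorem measurable_torusFun (c k : ℤ) (F : spectralSubspace c k) : Measurable (torusFun c k F) := by
  have h1 : Measurable fun w : UnitAddCircle × UnitAddCircle => frac w.1 :=
    measurable_frac.comp measurable_fst
  have h2 : Measurable fun w : UnitAddCircle × UnitAddCircle => frac w.2 :=
    measurable_frac.comp measurable_snd
  have h3 : Measurable fun w : UnitAddCircle × UnitAddCircle =>
      F.1 (HeisenbergManifold.mk c (frac w.1, frac w.2, 0)) :=
    (F.1.continuous.comp (HeisenbergManifold.continuous_mk c)).measurable.comp
      (h1.prodMk (h2.prodMk measurable_const))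
  unfold torusFun
  fun_prop

theorem norm_torusFun_le (c k : ℤ) (F : spectralSubspace c k)
    (w : UnitAddCircle × UnitAddCircle) : ‖torusFun c k F w‖ ≤ ‖F.1‖ := by
  have h : ‖Complex.exp (2 * Real.pi * Complex.I * c * k * frac w.1 * frac w.2)‖ = 1 := by
    rw [← norm_exp_two_pi_I_mul (c * k * frac w.1 * frac w.2)]
    congr 2
    push_cast
    ring
  rw [torusFun, norm_mul, h, one_mul]
  exact F.1.norm_coe_le_norm _

theorem memLp_torusFun (c k : ℤ) (F : spectralSubspace c k) : MemLp (torusFun c k F) 2 :=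
  memLp_two_of_bound (measurable_torusFun c k F) (norm_torusFun_le c k F)

/-- Lattice invariance and gauge equivariance determine `F` from its values at the points `[{x},
{y}, 0]`, which are the ones `torusFun` records. -/
theorem spectral_eq_sectionFun {c : ℤ} (hc : c ≠ 0) (k : ℤ) (F : spectralSubspace c k)
    (u : Cylinder) : F.1 (toManifold c u) = sectionFun c k (torusFun c k F) u := by
  obtain ⟨x, y, z⟩ := u
  induction y using QuotientAddGroup.induction_on with | _ y
  induction z using QuotientAddGroup.induction_on with | _ z
  have hx : Int.fract x = x - ⌊x⌋ := rfl
  have hc' : (c : ℝ) ≠ 0 := by exact_mod_cast hc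
  -- Right translation of `({x}, {y}, w)` by `(⌊x⌋, ⌊y⌋, 0)` adds `{y}⌊x⌋` to `w`, hence `w = z -
  -- {y}⌊x⌋`; the factor `c` undoes the division in `gauge`.
  have h1 : HeisenbergManifold.mk c (x, y, z) =
      gauge c (c * (z - Int.fract y * ⌊x⌋)) (HeisenbergManifold.mk c
        (Int.fract x, Int.fract y, 0)) := by
    change _ = HeisenbergManifold.mk c (Int.fract x, Int.fract y, 0 + _)
    refine Eq.symm (Quotient.sound (s := heisenbergSetoid c)
      ⟨⌊x⌋, ⌊y⌋, 0, ⟨0, by simp⟩, ?_⟩)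
    ext
    · exact (Int.fract_add_floor x).symm
    · exact (Int.fract_add_floor y).symm
    · field_simp
      ring
  change F.1 (HeisenbergManifold.mk c (x, y, z)) = sectionFun c k (torusFun c k F) (x, y, z)
  rw [h1, F.2]
  simp only [sectionFun, torusFun, proj, phase, fourier_one_coe, frac_coe]
  rw [← mul_assoc, ← Complex.exp_add, ← Complex.exp_add, hx]
  congr 2
  push_cast
  ring

theorem gnsIsometry_ofSpectral {c : ℤ} (hc : c ≠ 0) (μ ν : ℝ) (k : ℤ)
    (F : spectralSubspace c k) :
    gnsIsometry c μ ν (toL2 c μ ν (ofSpectral c μ ν k F)) =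
      sectionIsometry c μ k (memLp_torusFun c k F).toLp := by
  rw [gnsIsometry_toL2]
  exact ((toOperator_ofSpectral c μ ν k F).congr
    (spectral_eq_sectionFun hc k F)).apply_cellVector _

theorem isTwistedBy_sectionFun (c : ℤ) (μ ν : ℝ) (k : ℤ)
    {h : UnitAddCircle × UnitAddCircle → ℂ} (hh : Measurable h) {C : ℝ} (hC : ∀ w, ‖h w‖ ≤ C) :
    ∃ T, IsTwistedBy μ ν k (sectionFun c k h) T :=
  ⟨_, isTwistedBy_twistedMul μ ν k (memLp_sectionFun c k hh hC)⟩

/-- Both sides are closed, so generators suffice. Elements of `B_k` come from `torusFun`;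
conversely, the Fourier characters span a dense subspace of `L²(𝕋²)`, and their sections are limits
of vectors from `B_k`. -/
theorem map_completedSpectral {c : ℤ} (hc : c ≠ 0) (μ ν : ℝ) (k : ℤ) :
    (completedSpectral c μ ν k).map (gnsIsometry c μ ν).toLinearMap =
      LinearMap.range (sectionIsometry c μ k).toLinearMap := by
  have hcl : IsClosed (LinearMap.range (sectionIsometry c μ k).toLinearMap : Set H) := by
    rw [LinearMap.coe_range]
    exact (sectionIsometry c μ k).isometry.isClosedEmbedding.isClosed_range
  have hcl' : IsClosed ((completedSpectral c μ ν k).map (gnsIsometry c μ ν).toLinearMap :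
      Set H) := by
    have := (gnsIsometry c μ ν).isometry.isClosedEmbedding.isClosedMap _
      (Submodule.isClosed_topologicalClosure (Submodule.span ℂ
        (range fun F : spectralSubspace c k => toL2 c μ ν (ofSpectral c μ ν k F))))
    simpa [completedSpectral] using this
  refine le_antisymm ?_ ?_
  · rw [Submodule.map_le_iff_le_comap]
    refine Submodule.topologicalClosure_minimal _ (Submodule.span_le.2 ?_)
      (hcl.preimage (gnsIsometry c μ ν).continuous)
    rintro _ ⟨F, rfl⟩
    exact ⟨_, (gnsIsometry_ofSpectral hc μ ν k F).symm⟩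
  · obtain ⟨b, hb⟩ := exists_hilbertBasis_character (ω := fun _ => 1) measurable_const
      (fun _ => norm_one)
    have h1 : Submodule.span ℂ (range b) ≤
        ((completedSpectral c μ ν k).map (gnsIsometry c μ ν).toLinearMap).comap
          (sectionIsometry c μ k).toLinearMap := by
      refine Submodule.span_le.2 ?_
      rintro _ ⟨⟨m, n⟩, rfl⟩
      rw [hb]
      have hn : ∀ w, ‖character (fun _ => 1) m n w‖ ≤ 1 :=
        fun w => (norm_character (fun _ => norm_one) m n w).le
      obtain ⟨T, hT⟩ := isTwistedBy_sectionFun c μ ν k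
        (measurable_character measurable_const m n) hn
      obtain ⟨F, hF⟩ := exists_spectral_tendsto hc
        (by unfold character; fun_prop) hn hT
      -- Strong convergence is evaluated at `χ`, where it becomes convergence in the image of the
      -- GNS space.
      have h2 := hF cellVector
      rw [hT.apply_cellVector (memLp_character measurable_const (fun _ => norm_one) m n)] at h2
      refine hcl'.mem_of_tendsto h2 (Eventually.of_forall fun j => ?_)
      exact ⟨_, (toCompleted c μ ν k (F j)).2, gnsIsometry_toL2 c μ ν _⟩
    have h2 := Submodule.topologicalClosure_minimal _ h1
      (hcl'.preimage (sectionIsometry c μ k).continuous)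
    rw [b.dense_span] at h2
    rintro _ ⟨f, rfl⟩
    exact h2 Submodule.mem_top

/-- The unitary isomorphism of `B̄_k` with `L²(𝕋²)`. -/
theorem exists_completedSpectral_equiv {c : ℤ} (hc : c ≠ 0) (μ ν : ℝ) (k : ℤ) :
    ∃ Φ : completedSpectral c μ ν k ≃ₗᵢ[ℂ]
        Lp ℂ 2 (volume : Measure (UnitAddCircle × UnitAddCircle)),
      ∀ η, sectionIsometry c μ k (Φ η) = gnsIsometry c μ ν η := by
  let J : completedSpectral c μ ν k →ₗᵢ[ℂ] H :=
    (gnsIsometry c μ ν).comp (completedSpectral c μ ν k).subtypeₗᵢ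
  have hJ : LinearMap.range J.toLinearMap =
      LinearMap.range (sectionIsometry c μ k).toLinearMap := by
    rw [← map_completedSpectral hc μ ν k]
    ext v
    simp [J, Submodule.mem_map]
  refine ⟨(J.equivRange.trans (LinearIsometryEquiv.ofEq _ _ hJ)).trans
    (sectionIsometry c μ k).equivRange.symm, fun η => ?_⟩
  have := congrArg Subtype.val ((sectionIsometry c μ k).equivRange.apply_symm_apply
    (LinearIsometryEquiv.ofEq _ _ hJ (J.equivRange η)))
  exact this

theorem exists_completedSpectral_equiv_torusFun {c : ℤ} (hc : c ≠ 0) (μ ν : ℝ) (k : ℤ) :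
    ∃ Φ : completedSpectral c μ ν k ≃ₗᵢ[ℂ]
        Lp ℂ 2 (volume : Measure (UnitAddCircle × UnitAddCircle)),
      ∀ F : spectralSubspace c k, (Φ (toCompleted c μ ν k F) : UnitAddCircle × UnitAddCircle → ℂ)
        =ᵐ[volume] torusFun c k F := by
  obtain ⟨Φ, hΦ⟩ := exists_completedSpectral_equiv hc μ ν k
  refine ⟨Φ, fun F => ?_⟩
  have h : Φ (toCompleted c μ ν k F) = (memLp_torusFun c k F).toLp := by
    apply (sectionIsometry c μ k).injective
    rw [hΦ]
    exact gnsIsometry_ofSpectral hc μ ν k F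
  rw [h]
  exact MemLp.coeFn_toLp _

/-! ### The monomials -/

theorem isTwistedBy_intPow_fourier {c : ℤ} {μ ν : ℝ} {T : H →L[ℂ] H}
    {p : UnitAddCircle × UnitAddCircle → UnitAddCircle} (hp : Measurable p)
    (hT : IsTwistedBy μ ν 0 (sectionFun c 0 fun w => fourier 1 (p w)) T) (n : ℤ) :
    IsTwistedBy μ ν 0 (sectionFun c 0 fun w => fourier n (p w)) (intPow T n) := by
  have hm : Measurable fun w => (fourier 1 (p w) : ℂ) := (fourier 1).continuous.measurable.comp hp
  have hs := hT.star (measurable_sectionFun c 0 hm) (C := 1)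
    (fun u => by rw [norm_sectionFun]; exact (norm_fourier_apply _ _).le)
  refine intPow_induction (P := fun n S =>
    IsTwistedBy μ ν 0 (sectionFun c 0 fun w => fourier n (p w)) S) ?_ ?_ ?_ n
  · exact (IsTwistedBy.one μ ν).congr fun u => by simp [sectionFun, phase_zero]
  · intro n S hS
    refine (hS.mul hT).congr fun u => ?_
    simp only [sectionFun, phase_zero, flow_zero, one_mul]
    rw [fourier_add]
  · intro n S hS
    refine (hS.mul hs).congr fun u => ?_
    simp only [sectionFun, phase_zero, flow_zero, one_mul, neg_zero]
    rw [sub_eq_add_neg, fourier_add, fourier_neg]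
    rfl

/-- Each factor of `W` or `W*` multiplies the weight by further unimodular cocycle values. Only
measurability and modulus one matter later, so no formula for `ω` is recorded. -/
theorem exists_isTwistedBy_intPow_W (c : ℤ) (μ ν : ℝ) (k : ℤ) :
    ∃ ω : UnitAddCircle × UnitAddCircle → ℂ, Measurable ω ∧ (∀ w, ‖ω w‖ = 1) ∧
      IsTwistedBy μ ν k (sectionFun c k ω) (intPow (W c μ ν) k) := by
  have hmul : ∀ (k l : ℤ) (S T : H →L[ℂ] H),
      (∃ ω : UnitAddCircle × UnitAddCircle → ℂ, Measurable ω ∧ (∀ w, ‖ω w‖ = 1) ∧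
        IsTwistedBy μ ν k (sectionFun c k ω) S) →
      (∃ ω : UnitAddCircle × UnitAddCircle → ℂ, Measurable ω ∧ (∀ w, ‖ω w‖ = 1) ∧
        IsTwistedBy μ ν l (sectionFun c l ω) T) →
      (∃ ω : UnitAddCircle × UnitAddCircle → ℂ, Measurable ω ∧ (∀ w, ‖ω w‖ = 1) ∧
        IsTwistedBy μ ν (k + l) (sectionFun c (k + l) ω) (S * T)) := by
    rintro k l S T ⟨ω, h1, h2, h3⟩ ⟨ω', h1', h2', h3'⟩
    exact ⟨_, ((measurable_cocycle c μ ν k l).mul h1).mul (h1'.comp (measurable_rotation μ ν k)),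
      fun w => by simp [norm_cocycle, h2, h2'],
      (h3.mul h3').congr (sectionFun_mul_sectionFun_flow c μ ν k l ω ω')⟩
  refine intPow_induction (P := fun k S => ∃ ω : UnitAddCircle × UnitAddCircle → ℂ,
    Measurable ω ∧ (∀ w, ‖ω w‖ = 1) ∧ IsTwistedBy μ ν k (sectionFun c k ω) S) ?_ ?_ ?_ k
  · exact ⟨fun _ => 1, measurable_const, fun _ => norm_one,
      (IsTwistedBy.one μ ν).congr fun u => by simp [sectionFun, phase_zero]⟩
  · exact fun n S hS => hmul n 1 S _ hS
      ⟨_, measurable_const, fun _ => norm_one, isTwistedBy_W c μ ν⟩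
  · refine fun n S hS => hmul n (-1) S _ hS ⟨_, ?_, fun w => ?_,
      star_isTwistedBy_sectionFun (isTwistedBy_W c μ ν) measurable_const (fun _ => norm_one.le)⟩
    · exact (continuous_star.measurable.comp (measurable_cocycle c μ ν (-1) 1)).mul
        measurable_const
    · simp [norm_cocycle]

/-- One `ω` serves all `m` and `n`; this uniformity is what lets `exists_hilbertBasis_character`
apply to the whole family of degree `k`. -/
theorem exists_isTwistedBy_monomial (c : ℤ) (μ ν : ℝ) (k : ℤ) :
    ∃ ω : UnitAddCircle × UnitAddCircle → ℂ, Measurable ω ∧ (∀ w, ‖ω w‖ = 1) ∧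
      ∀ m n, IsTwistedBy μ ν k (sectionFun c k (character ω m n)) (monomial c μ ν m n k) := by
  obtain ⟨ω, h1, h2, h3⟩ := exists_isTwistedBy_intPow_W c μ ν k
  refine ⟨ω, h1, h2, fun m n => ?_⟩
  have h := ((isTwistedBy_intPow_fourier measurable_fst (isTwistedBy_U c μ ν) m).mul
    (isTwistedBy_intPow_fourier measurable_snd (isTwistedBy_V c μ ν) n)).mul h3
  rw [zero_add, zero_add] at h
  refine h.congr fun u => ?_
  simp only [sectionFun, phase_zero, flow_zero, one_mul, character]
  ring

/-- The monomials of degree `k` are an orthonormal basis of `B̄_k`. -/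
theorem exists_hilbertBasis_completedSpectral {c : ℤ} (hc : c ≠ 0) (μ ν : ℝ) (k : ℤ) :
    ∃ b : HilbertBasis (ℤ × ℤ) ℂ (completedSpectral c μ ν k), ∀ m n : ℤ,
      gnsIsometry c μ ν (b (m, n)) = monomial c μ ν m n k cellVector := by
  obtain ⟨Φ, hΦ⟩ := exists_completedSpectral_equiv hc μ ν k
  obtain ⟨ω, h1, h2, h3⟩ := exists_isTwistedBy_monomial c μ ν k
  obtain ⟨b₀, hb₀⟩ := exists_hilbertBasis_character h1 h2
  have : CompleteSpace (completedSpectral c μ ν k) :=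
    (Submodule.isClosed_topologicalClosure _).completeSpace_coe
  obtain ⟨b, hb⟩ := exists_hilbertBasis_of_isometryEquiv (Equiv.refl _) b₀ Φ.symm
  refine ⟨b, fun m n => ?_⟩
  rw [← hΦ, hb, LinearIsometryEquiv.apply_symm_apply, Equiv.refl_apply, hb₀,
    (h3 m n).apply_cellVector (memLp_character h1 h2 m n)]

/-! ### Decomposition of the GNS space -/

/-- A rotation in `z` preserves the measure and the cells, while it multiplies the integrand by
`e^{2πi(l-k)cs}`. With `s` chosen to make this factor `-1`, the integral equals its own negative. -/
theorem inner_sectionIsometry_of_ne {c : ℤ} (hc : c ≠ 0) (μ : ℝ) {k l : ℤ} (hkl : k ≠ l)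
    (f g : Lp ℂ 2 (volume : Measure (UnitAddCircle × UnitAddCircle))) :
    inner ℂ (sectionIsometry c μ k f) (sectionIsometry c μ l g) = 0 := by
  set s : ℝ := 1 / (2 * (l - k) * c) with hs
  set R : Cylinder → Cylinder := fun u => (u.1, u.2.1, u.2.2 + (s : UnitAddCircle)) with hR
  have hmp : MeasurePreserving R :=
    (MeasurePreserving.id volume).prod ((MeasurePreserving.id volume).prod
      (measurePreserving_add_right (volume : Measure UnitAddCircle) _))
  have hcoe : ∀ (j : ℤ) (h : Lp ℂ 2 (volume : Measure (UnitAddCircle × UnitAddCircle))),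
      (sectionIsometry c μ j h : Cylinder → ℂ) =ᵐ[volume]
        (cell μ j).indicator (sectionFun c j h) := fun j h => by
    have := coeFn_sectionIsometry c μ j (Lp.memLp h)
    rwa [Lp.toLp_coeFn] at this
  have hrot : ∀ (j : ℤ) (h : UnitAddCircle × UnitAddCircle → ℂ) (u : Cylinder),
      (cell μ j).indicator (sectionFun c j h) (R u) =
        fourier (j * c) (s : UnitAddCircle) * (cell μ j).indicator (sectionFun c j h) u := by
    intro j h u
    have h1 : R u ∈ cell μ j ↔ u ∈ cell μ j := by simp [cell, hR]
    by_cases hu : u ∈ cell μ j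
    · rw [indicator_of_mem hu, indicator_of_mem (h1.2 hu)]
      have hadd : (fourier (j * c) (u.2.2 + (s : UnitAddCircle)) : ℂ) =
          fourier (j * c) u.2.2 * fourier (j * c) (s : UnitAddCircle) := by
        simp only [fourier_apply, smul_add, AddCircle.toCircle_add, Circle.coe_mul]
      simp only [sectionFun, phase, proj, hR, hadd]
      ring
    · rw [indicator_of_notMem hu, indicator_of_notMem (mt h1.1 hu), mul_zero]
  have hneg : star (fourier (k * c) (s : UnitAddCircle) : ℂ) *
      fourier (l * c) (s : UnitAddCircle) = -1 := by
    have h1 : star (fourier (k * c) (s : UnitAddCircle) : ℂ) =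
        fourier (-(k * c)) (s : UnitAddCircle) := fourier_neg.symm
    rw [h1, ← fourier_add, fourier_one_coe, ← Complex.exp_pi_mul_I]
    congr 1
    have hc' : (c : ℂ) ≠ 0 := by exact_mod_cast hc
    have hkl' : (l : ℂ) - k ≠ 0 := sub_ne_zero.2 (by exact_mod_cast hkl.symm)
    rw [hs]
    push_cast
    field_simp
    ring
  have hint := integral_eq_integral_comp hmp
    (f := fun u => inner ℂ (sectionIsometry c μ k f u) (sectionIsometry c μ l g u))
    ((Lp.aestronglyMeasurable _).inner (Lp.aestronglyMeasurable _))
  have hR' : ∫ u, inner ℂ (sectionIsometry c μ k f (R u)) (sectionIsometry c μ l g (R u)) =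
      ∫ u, -inner ℂ (sectionIsometry c μ k f u) (sectionIsometry c μ l g u) := by
    refine integral_congr_ae ?_
    filter_upwards [hcoe k f, hcoe l g, hmp.quasiMeasurePreserving.ae_eq_comp (hcoe k f),
      hmp.quasiMeasurePreserving.ae_eq_comp (hcoe l g)] with u e1 e2 e3 e4
    simp only [Function.comp_apply] at e3 e4
    rw [e1, e2, e3, e4, hrot, hrot]
    simp only [RCLike.inner_apply, map_mul]
    rw [RCLike.star_def] at hneg
    linear_combination ((cell μ l).indicator (sectionFun c l g) u *
      (starRingEnd ℂ) ((cell μ k).indicator (sectionFun c k f) u)) * hneg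
  rw [L2.inner_def]
  rw [hR', integral_neg] at hint
  exact self_eq_neg.1 hint

/-- The closed span of the ranges of the isometries `L²(𝕋²) → L²(ℝ × 𝕋²)`. -/
def sectionSpace (c : ℤ) (μ : ℝ) : Submodule ℂ H :=
  (⨆ k, LinearMap.range (sectionIsometry c μ k).toLinearMap).topologicalClosure

theorem isClosed_sectionSpace (c : ℤ) (μ : ℝ) : IsClosed (sectionSpace c μ : Set H) :=
  Submodule.isClosed_topologicalClosure _

theorem sectionIsometry_mem_sectionSpace (c : ℤ) (μ : ℝ) (k : ℤ)
    (f : Lp ℂ 2 (volume : Measure (UnitAddCircle × UnitAddCircle))) :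
    sectionIsometry c μ k f ∈ sectionSpace c μ :=
  Submodule.le_topologicalClosure _ (Submodule.mem_iSup_of_mem k ⟨f, rfl⟩)

theorem IsTwistedBy.apply_mem_sectionSpace {c : ℤ} {μ ν : ℝ} {k : ℤ}
    {h : UnitAddCircle × UnitAddCircle → ℂ} {T : H →L[ℂ] H}
    (hT : IsTwistedBy μ ν k (sectionFun c k h) T) (hh : Measurable h) {C : ℝ}
    (hC : ∀ w, ‖h w‖ ≤ C) {v : H} (hv : v ∈ sectionSpace c μ) : T v ∈ sectionSpace c μ := by
  have h1 : (⨆ k, LinearMap.range (sectionIsometry c μ k).toLinearMap) ≤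
      (sectionSpace c μ).comap T.toLinearMap := by
    refine iSup_le fun l => ?_
    rintro _ ⟨f, rfl⟩
    have := hT.apply_sectionIsometry l (Lp.memLp f)
      (memLp_mul_rotation c μ ν k l hh hC (Lp.memLp f))
    rw [Lp.toLp_coeFn] at this
    change T (sectionIsometry c μ l f) ∈ sectionSpace c μ
    rw [this]
    exact sectionIsometry_mem_sectionSpace c μ _ _
  exact Submodule.topologicalClosure_minimal _ h1
    ((isClosed_sectionSpace c μ).preimage T.continuous) hv

theorem cellVector_mem_sectionSpace (c : ℤ) (μ : ℝ) : cellVector ∈ sectionSpace c μ := by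
  -- `χ` is the image of the constant function `1` in degree `0`. The section space does not involve
  -- `ν`, so `0` is an arbitrary value for it.
  have h : IsTwistedBy μ 0 0 (sectionFun c 0 fun _ => 1) 1 :=
    (IsTwistedBy.one μ 0).congr fun u => by simp [sectionFun, phase_zero]
  have := h.apply_cellVector (memLp_two_of_bound measurable_const fun _ => norm_one.le)
  rw [one_apply_eq_self] at this
  rw [this]
  exact sectionIsometry_mem_sectionSpace c μ _ _

theorem toOperator_apply_mem_sectionSpace {c : ℤ} (hc : c ≠ 0) (μ ν : ℝ)
    (a : QuantumHeisenberg c μ ν) : toOperator c μ ν a cellVector ∈ sectionSpace c μ := by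
  -- Products require invariance of the whole subspace and not just the image of `χ`; carrying `T`
  -- and its adjoint together makes the `star` case of the induction a swap.
  have hadj : ∀ T ∈ StarAlgebra.adjoin ℂ {T : H →L[ℂ] H | ∃ k : ℤ,
      ∃ F ∈ spectralSubspace c k, T = twistedMul μ ν k (pullback c F)},
      (∀ v ∈ sectionSpace c μ, T v ∈ sectionSpace c μ) ∧
        (∀ v ∈ sectionSpace c μ, star T v ∈ sectionSpace c μ) := by
    intro T hT
    induction hT using StarAlgebra.adjoin_induction with
    | mem T h =>
      obtain ⟨k, F, hF, rfl⟩ := h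
      have h1 : IsTwistedBy μ ν k (sectionFun c k (torusFun c k ⟨F, hF⟩))
          (twistedMul μ ν k (pullback c F)) :=
        (toOperator_ofSpectral c μ ν k ⟨F, hF⟩).congr (spectral_eq_sectionFun hc k _)
      have hm := measurable_torusFun c k ⟨F, hF⟩
      have hb := norm_torusFun_le c k ⟨F, hF⟩
      refine ⟨fun v hv => h1.apply_mem_sectionSpace hm hb hv, fun v hv => ?_⟩
      refine (star_isTwistedBy_sectionFun h1 hm hb).apply_mem_sectionSpace (C := ‖F‖) ?_ ?_ hv
      · exact (continuous_star.measurable.comp (measurable_cocycle c μ ν (-k) k)).mul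
          (continuous_star.measurable.comp (hm.comp (measurable_rotation μ ν (-k))))
      · intro w
        rw [norm_mul, norm_star, norm_star, norm_cocycle, one_mul]
        exact hb _
    | algebraMap r =>
      have h : ∀ (z : ℂ), ∀ v ∈ sectionSpace c μ,
          (algebraMap ℂ (H →L[ℂ] H) z) v ∈ sectionSpace c μ := fun z v hv => by
        rw [Algebra.algebraMap_eq_smul_one]
        exact (sectionSpace c μ).smul_mem z hv
      refine ⟨h r, ?_⟩
      rw [← algebraMap_star_comm]
      exact h _
    | add S T _ _ hS hT =>
      refine ⟨fun v hv => add_mem (hS.1 v hv) (hT.1 v hv), fun v hv => ?_⟩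
      rw [star_add]
      exact add_mem (hS.2 v hv) (hT.2 v hv)
    | mul S T _ _ hS hT =>
      refine ⟨fun v hv => hS.1 _ (hT.1 v hv), fun v hv => ?_⟩
      rw [star_mul]
      exact hT.2 _ (hS.2 v hv)
    | star T _ hT =>
      refine ⟨hT.2, ?_⟩
      rw [star_star]
      exact hT.1
  -- Evaluation at `χ` is norm continuous, so the inclusion passes from the generated algebra to its
  -- closure.
  have hclosed : IsClosed {T : H →L[ℂ] H | T cellVector ∈ sectionSpace c μ} :=
    (isClosed_sectionSpace c μ).preimage (ContinuousLinearMap.apply ℂ H cellVector).continuous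
  have ha : (toOperator c μ ν a) ∈ closure (StarAlgebra.adjoin ℂ {T : H →L[ℂ] H | ∃ k : ℤ,
      ∃ F ∈ spectralSubspace c k, T = twistedMul μ ν k (pullback c F)} : Set (H →L[ℂ] H)) := by
    rw [← StarSubalgebra.topologicalClosure_coe]
    exact a.2
  exact closure_minimal (fun T hT => (hadj T hT).1 _ (cellVector_mem_sectionSpace c μ))
    hclosed ha

/-- The monomials are an orthonormal basis of `L²(D^c_{μν}, τ)`. -/
theorem exists_hilbertBasis_L2 {c : ℤ} (hc : c ≠ 0) (μ ν : ℝ) :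
    ∃ b : HilbertBasis (ℤ × ℤ × ℤ) ℂ (L2 c μ ν), ∀ m n k : ℤ,
      gnsIsometry c μ ν (b (m, n, k)) = monomial c μ ν m n k cellVector := by
  choose b hb using fun k => exists_hilbertBasis_completedSpectral hc μ ν k
  let v : ℤ × ℤ × ℤ → L2 c μ ν := fun i => (b i.2.2 (i.1, i.2.1) : L2 c μ ν)
  have hv : Orthonormal ℂ v := by
    constructor
    · rintro ⟨m, n, k⟩
      exact (b k).orthonormal.1 (m, n)
    · rintro ⟨m, n, k⟩ ⟨m', n', k'⟩ hne
      by_cases hk : k = k'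
      · subst hk
        have : (m, n) ≠ (m', n') := fun h => hne (by
          rw [Prod.mk.injEq] at h
          rw [h.1, h.2])
        exact (b k).orthonormal.2 this
      · obtain ⟨Φ, hΦ⟩ := exists_completedSpectral_equiv hc μ ν k
        obtain ⟨Φ', hΦ'⟩ := exists_completedSpectral_equiv hc μ ν k'
        change inner ℂ (b k (m, n) : L2 c μ ν) (b k' (m', n') : L2 c μ ν) = 0
        rw [← LinearIsometry.inner_map_map (gnsIsometry c μ ν), ← hΦ, ← hΦ']
        exact inner_sectionIsometry_of_ne hc μ hk _ _
  have hk : ∀ k, completedSpectral c μ ν k ≤ (Submodule.span ℂ (range v)).topologicalClosure := by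
    intro k η hη
    have h1 : Submodule.span ℂ (range (b k)) ≤
        ((Submodule.span ℂ (range v)).topologicalClosure).comap
          (completedSpectral c μ ν k).subtype := by
      refine Submodule.span_le.2 ?_
      rintro _ ⟨⟨m, n⟩, rfl⟩
      exact Submodule.le_topologicalClosure _ (Submodule.subset_span ⟨(m, n, k), rfl⟩)
    have h2 := Submodule.topologicalClosure_minimal _ h1
      ((Submodule.isClosed_topologicalClosure _).preimage continuous_subtype_val)
    rw [(b k).dense_span] at h2
    exact h2 (Submodule.mem_top (x := (⟨η, hη⟩ : completedSpectral c μ ν k)))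
  have hcl : IsClosed (((Submodule.span ℂ (range v)).topologicalClosure.map
      (gnsIsometry c μ ν).toLinearMap : Submodule ℂ H) : Set H) := by
    rw [Submodule.map_coe]
    exact (gnsIsometry c μ ν).isometry.isClosedEmbedding.isClosedMap _
      (Submodule.isClosed_topologicalClosure _)
  -- The image of a complete subspace under an isometry is closed, so it suffices to contain each
  -- range, that is, the image of each `B̄_k`.
  have hle : sectionSpace c μ ≤ (Submodule.span ℂ (range v)).topologicalClosure.map
      (gnsIsometry c μ ν).toLinearMap := by
    refine Submodule.topologicalClosure_minimal _ (iSup_le fun k => ?_) hcl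
    rw [← map_completedSpectral hc μ ν k]
    exact Submodule.map_mono (hk k)
  have htop : ⊤ ≤ (Submodule.span ℂ (range v)).topologicalClosure := by
    intro η _
    refine (denseRange_toL2 c μ ν).induction_on (p := fun η =>
      η ∈ (Submodule.span ℂ (range v)).topologicalClosure) η
      (Submodule.isClosed_topologicalClosure _) fun a => ?_
    -- `ζ` and the class of `a` have the same image under the injective `gnsIsometry`, hence
    -- coincide; density of the algebra does the rest.
    obtain ⟨ζ, hζ, hζ'⟩ := hle (toOperator_apply_mem_sectionSpace hc μ ν a)
    rw [← gnsIsometry_toL2] at hζ'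
    rwa [← (gnsIsometry c μ ν).injective hζ']
  refine ⟨HilbertBasis.mk hv htop, fun m n k => ?_⟩
  rw [HilbertBasis.coe_mk]
  exact hb k m n

end QHM

end

theorem corollary7p4 (c : ℤ) (hc : c ≠ 0) (μ ν : ℝ) :
    (∀ k : ℤ,
      (∃ Φ : QHM.completedSpectral c μ ν k ≃ₗᵢ[ℂ]
          MeasureTheory.Lp ℂ 2 (MeasureTheory.volume :
            MeasureTheory.Measure (UnitAddCircle × UnitAddCircle)),
        ∀ F : QHM.spectralSubspace c k,
          (Φ (QHM.toCompleted c μ ν k F) : UnitAddCircle × UnitAddCircle → ℂ)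
            =ᵐ[MeasureTheory.volume] fun w =>
              Complex.exp (2 * Real.pi * Complex.I * c * k * QHM.frac w.1 * QHM.frac w.2) *
                F.1 (QHM.HeisenbergManifold.mk c (QHM.frac w.1, QHM.frac w.2, 0))) ∧
      (∃ b : HilbertBasis (ℤ × ℤ) ℂ (QHM.completedSpectral c μ ν k),
        ∀ m n : ℤ,
          QHM.IsClassOf c μ ν (b (m, n) : QHM.L2 c μ ν) (QHM.monomial c μ ν m n k))) ∧
    (∃ b : HilbertBasis (ℤ × ℤ × ℤ) ℂ (QHM.L2 c μ ν),
      ∀ m n k : ℤ, QHM.IsClassOf c μ ν (b (m, n, k)) (QHM.monomial c μ ν m n k)) := by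
  refine ⟨fun k => ⟨QHM.exists_completedSpectral_equiv_torusFun hc μ ν k, ?_⟩, ?_⟩
  · obtain ⟨b, hb⟩ := QHM.exists_hilbertBasis_completedSpectral hc μ ν k
    exact ⟨b, fun m n => QHM.isClassOf_of_gnsIsometry_eq
      (QHM.monomial_mem_vonNeumann hc μ ν m n k) (hb m n)⟩
  · obtain ⟨b, hb⟩ := QHM.exists_hilbertBasis_L2 hc μ ν
    exact ⟨b, fun m n k => QHM.isClassOf_of_gnsIsometry_eq
      (QHM.monomial_mem_vonNeumann hc μ ν m n k) (hb m n k)⟩
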